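/- For a finite simple graph $G$ with $n$ vertices, $m$ edges and $c(G)$ connected components let $\omega(G)=m-n+c(G)$. For $k\ge 2$, a set $S\subseteq V_G$ is a generalized $k$-independent set if the induced subgraph $G[S]$ contains no tree on $k$ vertices. Consider the following algorithm with input $(G,k)$. Phase A. Run depth-first search on every component of $G$ (with arbitrary choices of start vertices and of the next undiscovered neighbour), recording for each vertex its parent and its depth in the DFS forest. Let $X$ be the set of the deeper endpoints of all back edges (edges of $G$ that are not in the DFS forest), and let $U=V_G\setminus X$. Phase B. Put $S:=U$. Choose an arbitrary root in each component of $F=G[U]$ and call $\mathrm{CLP}(r,\mathrm{none})$ for each root $r$, where $\mathrm{CLP}(v,p)$ computes $s=1+\sum_w \mathrm{CLP}(w,v)$ over all neighbours $w\neq p$ of $v$ in $F$; then, if $s\ge k$, it removes $v$ from $S$ and returns $0$, and otherwise it returns $s$. Output $S$. (1) For every finite simple graph $G$, every $k\ge 2$ and all choices made by the algorithm: the endpoints of each back edge have different depths; there are exactly $\omega(G)$ back edges; $G[U]$ is a forest and $|U|\ge n-\omega(G)$; Phase B terminates; and every output $S\subseteq U$ is a generalized $k$-independent set, all components of $G[S]$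 have at most $k-1$ vertices, and $$|S|\ \ge\ \left\lceil \frac{k-1}{k}\,\bigl(n-\omega(G)\bigr)\right\rceil .$$ (2) The algorithm runs in time $O(n+m)$: there are a constant $C$ and programs $A$ and $B$ of a unit-cost RAM (registers and arrays; instructions for constants, copying, addition, truncated subtraction, array access, and branching and looping on a comparison) such that for every graph $G$ with vertex set $\{0,\dots,n-1\}$, given by arbitrary adjacency lists together with $n$, and every $k\ge2$, the program $A$ followed by $B$ halts after at most $C(n+m+1)$ steps, while no number larger than $C(n+m+k+1)$ is ever created. Here $A$ carries out Phase A (for some choice of the depth-first search), leaving the parents, the depths and the set $X$ in memory, and $B$ carries out Phase B (for some choice of the roots), leaving in memory the output $S$, which is thus a generalized $k$-independent set with $|S|\ge\lceil\frac{k-1}{k}(n-\omega(G))\rceil$. -/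

import Mathlib

namespace KIndep

/-! ### Graph notions -/

section Graph
variable {V : Type*}

/-- Dimension of the cycle space: `ω(G) = |E| - |V| + c(G)`. -/
noncomputable def cycleDim (G : SimpleGraph V) : ℤ :=
  (Nat.card G.edgeSet : ℤ) - (Nat.card V : ℤ) + (Nat.card G.ConnectedComponent : ℤ)

/-- `S` is a generalized `k`-independent set of `G`: the induced subgraph `G[S]` contains
no tree on `k` vertices (as a subgraph, not necessarily induced). -/
def IsGenIndep (G : SimpleGraph V) (k : ℕ) (S : Set V) : Prop :=
  ∀ H : (G.induce S).Subgraph, H.coe.IsTree → H.verts.ncard ≠ k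

/-! ### Phase A: depth-first search and the marked vertices -/

/-- A configuration of depth-first search; `parent v = none` means that `v` is a root or has not
been discovered. The head of `stack` is the vertex which is currently being explored. -/
structure DFSState (V : Type*) where
  parent : V → Option V
  depth : V → ℕ
  visited : Set V
  stack : List V

/-- The configuration before the search starts. -/
def DFSState.init (V : Type*) : DFSState V where
  parent := fun _ => none
  depth := fun _ => 0
  visited := ∅
  stack := []

open Classical in
/-- One step of (nondeterministic) depth-first search on all components of `G`. -/
inductive DFSStep (G : SimpleGraph V) : DFSState V → DFSState V → Prop
  /-- The stack is empty: start a new tree at some undiscovered vertex `r`. -/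
  | root (σ : DFSState V) (r : V) :
      σ.stack = [] → r ∉ σ.visited →
      DFSStep G σ
        { parent := Function.update σ.parent r none
          depth := Function.update σ.depth r 0
          visited := insert r σ.visited
          stack := [r] }
  /-- The current vertex `u` has an undiscovered neighbour `w`: descend to it. -/
  | descend (σ : DFSState V) (u w : V) (rest : List V) :
      σ.stack = u :: rest → G.Adj u w → w ∉ σ.visited →
      DFSStep G σ
        { parent := Function.update σ.parent w (some u)
          depth := Function.update σ.depth w (σ.depth u + 1)
          visited := insert w σ.visited
          stack := w :: u :: rest }
  /-- All neighbours of the current vertex `u` have been discovered: backtrack. -/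
  | backtrack (σ : DFSState V) (u : V) (rest : List V) :
      σ.stack = u :: rest → (∀ w, G.Adj u w → w ∈ σ.visited) →
      DFSStep G σ
        { parent := σ.parent
          depth := σ.depth
          visited := σ.visited
          stack := rest }

/-- `D` is the final configuration of a complete depth-first search of `G`. -/
def IsDFSResult (G : SimpleGraph V) (D : DFSState V) : Prop :=
  Relation.ReflTransGen (DFSStep G) (DFSState.init V) D ∧
    D.stack = [] ∧ ∀ v, v ∈ D.visited

/-- `uv` is a back edge: an edge of `G` which is not an edge of the DFS forest. -/
def IsBackEdge (G : SimpleGraph V) (D : DFSState V) (u v : V) : Prop :=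
  G.Adj u v ∧ D.parent u ≠ some v ∧ D.parent v ≠ some u

/-- The set of back edges, as unordered pairs. -/
def backEdges (G : SimpleGraph V) (D : DFSState V) : Set (Sym2 V) :=
  {e | ∃ u v, e = s(u, v) ∧ IsBackEdge G D u v}

/-- The set `X` of marked vertices: the deeper endpoints of the back edges. -/
def marked (G : SimpleGraph V) (D : DFSState V) : Set V :=
  {u | ∃ v, IsBackEdge G D u v ∧ D.depth v < D.depth u}

/-! ### Phase B: pruning the forest in post-order -/

/-- The graph `G[U]`, seen as a graph on `V` in which the vertices outside `U` are isolated. -/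
def restrict (G : SimpleGraph V) (U : Set V) : SimpleGraph V :=
  (G.induce U).spanningCoe

/-- `roots` lists exactly one vertex from each connected component of `G[U]`. -/
def IsRooting (G : SimpleGraph V) (U : Set V) (roots : List V) : Prop :=
  roots.Nodup ∧ (∀ r ∈ roots, r ∈ U) ∧
    ∀ v ∈ U, ∃! r, r ∈ roots ∧ (restrict G U).Reachable r v

mutual
/-- `Clp F k v p S S' s`: the recursive call `CLP(v, p)` in `F`, where `p` is the parent of `v`
(`none` at a root), terminates, changes the current set from `S` to `S'` and returns `s`. -/
inductive Clp (F : SimpleGraph V) (k : ℕ) :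
    V → Option V → Set V → Set V → ℕ → Prop
  | cut (v : V) (p : Option V) (ws : List V) (S S' : Set V) (s : ℕ) :
      ws.Nodup → (∀ w, w ∈ ws ↔ F.Adj v w ∧ p ≠ some w) →
      ClpLoop F k v ws 1 S S' s → k ≤ s →
      Clp F k v p S (S' \ {v}) 0
  | keep (v : V) (p : Option V) (ws : List V) (S S' : Set V) (s : ℕ) :
      ws.Nodup → (∀ w, w ∈ ws ↔ F.Adj v w ∧ p ≠ some w) →
      ClpLoop F k v ws 1 S S' s → s < k →
      Clp F k v p S S' s
/-- `ClpLoop F k v ws s S S' s'`: the loop `for w in ws: s ← s + CLP(w, v)` in the body of a call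
at `v` terminates, changes the current set from `S` to `S'` and the accumulator from `s`
to `s'`. -/
inductive ClpLoop (F : SimpleGraph V) (k : ℕ) :
    V → List V → ℕ → Set V → Set V → ℕ → Prop
  | nil (v : V) (s : ℕ) (S : Set V) : ClpLoop F k v [] s S S s
  | cons (v w : V) (ws : List V) (s r s' : ℕ) (S S' S'' : Set V) :
      Clp F k w (some v) S S' r →
      ClpLoop F k v ws (s + r) S' S'' s' →
      ClpLoop F k v (w :: ws) s S S'' s'
end

/-- `PruneFrom F k roots S S'`: calling `CLP(r, none)` for the roots `r` in turn terminates and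
changes the current set from `S` to `S'`. -/
inductive PruneFrom (F : SimpleGraph V) (k : ℕ) : List V → Set V → Set V → Prop
  | nil (S : Set V) : PruneFrom F k [] S S
  | cons (r : V) (rs : List V) (S S' S'' : Set V) (s : ℕ) :
      Clp F k r none S S' s → PruneFrom F k rs S' S'' → PruneFrom F k (r :: rs) S S''

/-- Phase B: starting with `S = U`, prune all trees of `G[U]` from the given roots; the output
is `S`. -/
def PhaseB (G : SimpleGraph V) (k : ℕ) (U : Set V) (roots : List V) (S : Set V) : Prop :=
  PruneFrom (restrict G U) k roots U S

end Graph

/-! ### The machine model: a word RAM with a step count -/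

/-- A memory: registers `reg x`, and arrays `arr a` with cells `arr a i`. -/
structure Mem where
  reg : ℕ → ℕ
  arr : ℕ → ℕ → ℕ

/-- Write a register. -/
def Mem.setReg (s : Mem) (x v : ℕ) : Mem :=
  { reg := Function.update s.reg x v, arr := s.arr }

/-- Write a cell of an array. -/
def Mem.setArr (s : Mem) (a i v : ℕ) : Mem :=
  { reg := s.reg, arr := Function.update s.arr a (Function.update (s.arr a) i v) }

/-- Programs. All arguments are fixed numbers: names of registers and arrays, and the literal `c`
in `const`. -/
inductive Cmd
  /-- no operation -/
  | skip
  /-- `x := c` -/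
  | const (x c : ℕ)
  /-- `x := y` -/
  | move (x y : ℕ)
  /-- `x := y + z` -/
  | add (x y z : ℕ)
  /-- `x := y - z`, truncated at `0` -/
  | sub (x y z : ℕ)
  /-- `x := a[i]`, where `i` is a register -/
  | load (x a i : ℕ)
  /-- `a[i] := x`, where `i` is a register -/
  | store (a i x : ℕ)
  /-- `p; q` -/
  | seq (p q : Cmd)
  /-- `if x < y then p else q` -/
  | ifLt (x y : ℕ) (p q : Cmd)
  /-- `while x < y do p` -/
  | whileLt (x y : ℕ) (p : Cmd)

/-- `Exec W p s t s'`: started in memory `s`, the program `p` halts after exactly `t` steps in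
memory `s'`. Every elementary instruction and every evaluation of a test takes one step. Words
hold the numbers `0, …, W`: an instruction that would create a larger number has no execution
(only `const` and `add` could do so). -/
inductive Exec (W : ℕ) : Cmd → Mem → ℕ → Mem → Prop
  | skip (s : Mem) : Exec W .skip s 1 s
  | const (s : Mem) (x c : ℕ) : c ≤ W → Exec W (.const x c) s 1 (s.setReg x c)
  | move (s : Mem) (x y : ℕ) : Exec W (.move x y) s 1 (s.setReg x (s.reg y))
  | add (s : Mem) (x y z : ℕ) : s.reg y + s.reg z ≤ W →
      Exec W (.add x y z) s 1 (s.setReg x (s.reg y + s.reg z))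
  | sub (s : Mem) (x y z : ℕ) :
      Exec W (.sub x y z) s 1 (s.setReg x (s.reg y - s.reg z))
  | load (s : Mem) (x a i : ℕ) :
      Exec W (.load x a i) s 1 (s.setReg x (s.arr a (s.reg i)))
  | store (s : Mem) (a i x : ℕ) :
      Exec W (.store a i x) s 1 (s.setArr a (s.reg i) (s.reg x))
  | seq (p q : Cmd) (s s' s'' : Mem) (t t' : ℕ) :
      Exec W p s t s' → Exec W q s' t' s'' → Exec W (.seq p q) s (t + t') s''
  | ifTrue (x y : ℕ) (p q : Cmd) (s s' : Mem) (t : ℕ) :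
      s.reg x < s.reg y → Exec W p s t s' → Exec W (.ifLt x y p q) s (t + 1) s'
  | ifFalse (x y : ℕ) (p q : Cmd) (s s' : Mem) (t : ℕ) :
      ¬ s.reg x < s.reg y → Exec W q s t s' → Exec W (.ifLt x y p q) s (t + 1) s'
  | whileTrue (x y : ℕ) (p : Cmd) (s s' s'' : Mem) (t t' : ℕ) :
      s.reg x < s.reg y → Exec W p s t s' → Exec W (.whileLt x y p) s' t' s'' →
      Exec W (.whileLt x y p) s (t + t' + 1) s''
  | whileFalse (x y : ℕ) (p : Cmd) (s : Mem) :
      ¬ s.reg x < s.reg y → Exec W (.whileLt x y p) s 1 s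

/-! ### Input and output on the machine -/

/-- `nb` is an adjacency-list representation of `G` (the lists may be in any order). -/
def IsAdjList {n : ℕ} (G : SimpleGraph (Fin n)) (nb : Fin n → List (Fin n)) : Prop :=
  ∀ v, (nb v).Nodup ∧ ∀ w, w ∈ nb v ↔ G.Adj v w

/-- The input: register `0` holds `n`, register `1` holds `k`, array `1` holds the concatenation
of the adjacency lists of the vertices `0, …, n - 1`, and array `0` holds the offsets: the list of
`v` occupies the cells `arr 0 v, …, arr 0 (v + 1) - 1` of array `1`. Everything else is `0`. -/
def inputMem {n : ℕ} (k : ℕ) (nb : Fin n → List (Fin n)) : Mem where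
  reg := fun x => if x = 0 then n else if x = 1 then k else 0
  arr := fun a i =>
    if a = 0 then (((List.finRange n).take i).map fun v => (nb v).length).sum
    else if a = 1 then (((List.finRange n).flatMap nb).map Fin.val).getD i 0
    else 0

/-- The subset of `Fin n` whose indicator vector is stored in array `a`. -/
def Mem.setIn (s : Mem) (n a : ℕ) : Set (Fin n) :=
  {v | s.arr a v = 1}

/-- The parents and depths of `D` are recorded in the arrays `2` and `3`
(with `0` for no parent, and `u + 1` for the parent `u`). -/
def Mem.Records {n : ℕ} (s : Mem) (D : DFSState (Fin n)) : Prop :=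
  ∀ v : Fin n, s.arr 2 v = (D.parent v).elim 0 (fun u => (u : ℕ) + 1) ∧
    s.arr 3 v = D.depth v

end KIndep

-- Depth-first search joins only comparable vertices: when `w` is discovered, each discovered
-- neighbour of `w` is still on the stack, and the stack is a chain of parents, so that neighbour is
-- an ancestor of `w` (`DFSInv.step`). Hence the endpoints of an edge have different depths, and
-- every component has exactly one root. There are then `n - c(G)` tree edges, which leaves `ω(G)`
-- back edges (`IsDFSResult.ncard_backEdges`). Each back edge marks one vertex, so at most `ω(G)`
-- vertices are marked. The unmarked ones span only tree edges, and these form a forest.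
--
-- In Phase B the chosen roots orient the forest. The subtotal `raw v` is 1 plus the values returned
-- by the children, where a cut vertex returns 0. By `clp_iff` a run has no freedom beyond this: it
-- keeps exactly the vertices with `raw v < k` (`phaseB_iff`). Summing the subtotals over `U` shows
-- that every cut vertex uses up at least `k` vertices of `U`, so at most `|U| / k` are cut
-- (`IsSubtotal.count`). A component of what is left hangs below its shallowest vertex `t` and has
-- at most `raw t < k` vertices (`ncard_supp_le`).
--
-- On the machine each phase is essentially one loop with a loop-free body, so its running time is a
-- constant times the initial value of a decreasing potential (`exec_whileLt`). Phase A keeps no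
-- stack: the current vertex and the parent array encode it, and each vertex has a pointer into its
-- adjacency list. Arrays 2, 3, 4 hold parents, depths and marks, array 6 the discovered flags,
-- array 7 the pointers, and array 8 the order of discovery. `DFSRep` ties this memory to a
-- configuration of the abstract search. Phase B replaces the recursion by a scan in reverse order
-- of discovery. Children are discovered after their parents, so the accumulators in array 9 are
-- complete when they are read; array 5 receives the output. Since the output depends only on the
-- subtotals, it is also that of a recursive run (`DFSRep.exec_pruneCmd`).

namespace KIndep

-- Rooted forests described by parent functions.

section ParentMap
variable {V : Type*}

/-- `u` is an ancestor of `v` (possibly `v` itself) with respect to the parent function `par`. -/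
def Anc (par : V → Option V) : V → V → Prop :=
  Relation.ReflTransGen fun a b => par b = some a

theorem Anc.depth_le {par : V → Option V} {dep : V → ℕ}
    (hdep : ∀ u v, par v = some u → dep u < dep v) {u v : V} (h : Anc par u v) :
    dep u ≤ dep v := by
  induction h with
  | refl => exact le_rfl
  | tail _ hbc ih => exact ih.trans (hdep _ _ hbc).le

theorem Anc.depth_lt {par : V → Option V} {dep : V → ℕ}
    (hdep : ∀ u v, par v = some u → dep u < dep v) {u v : V} (h : Anc par u v) (hne : u ≠ v) :
    dep u < dep v := by
  rcases Relation.ReflTransGen.cases_tail h with rfl | ⟨b, hub, hbv⟩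
  · exact absurd rfl hne
  · exact lt_of_le_of_lt (Anc.depth_le hdep hub) (hdep _ _ hbv)

theorem Anc.eq_of_none {par : V → Option V} {u v : V} (h : Anc par u v) (hv : par v = none) :
    u = v := by
  rcases Relation.ReflTransGen.cases_tail h with rfl | ⟨b, -, hbv⟩
  · rfl
  · simp [hv] at hbv

theorem Anc.root_unique {par : V → Option V} {r r' v : V} (h : Anc par r v) (h' : Anc par r' v)
    (hr : par r = none) (hr' : par r' = none) : r = r' := by
  induction h with
  | refl => exact (h'.eq_of_none hr).symm
  | tail _ hbc ih =>
    rcases Relation.ReflTransGen.cases_tail h' with rfl | ⟨b, hb, hbv⟩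
    · simp [hr'] at hbc
    · obtain rfl : b = _ := Option.some_injective _ (hbv.symm.trans hbc)
      exact ih hb

theorem exists_anc_root {par : V → Option V} {dep : V → ℕ}
    (hdep : ∀ u v, par v = some u → dep u < dep v) (v : V) :
    ∃ r, par r = none ∧ Anc par r v := by
  induction h : dep v using Nat.strong_induction_on generalizing v with
  | _ d ih =>
    rcases hp : par v with _ | u
    · exact ⟨v, hp, .refl⟩
    · obtain ⟨r, hr, hru⟩ := ih (dep u) (h ▸ hdep _ _ hp) u rfl
      exact ⟨r, hr, hru.tail hp⟩

/-- If adjacent vertices are comparable for the ancestor relation of a parent function, then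
vertices that can be reached from each other have the same root. -/
theorem root_eq_of_reachable {G : SimpleGraph V} {par : V → Option V} {dep : V → ℕ}
    (hdep : ∀ u v, par v = some u → dep u < dep v)
    (hadj : ∀ u v, G.Adj u v → Anc par u v ∨ Anc par v u) {u v r s : V}
    (h : G.Reachable u v) (hr : par r = none) (hs : par s = none)
    (hru : Anc par r u) (hsv : Anc par s v) : r = s := by
  obtain ⟨p⟩ := h
  induction p generalizing r with
  | nil => exact hru.root_unique hsv hr hs
  | @cons a b c hab p ih =>
    obtain ⟨t, ht, htb⟩ := exists_anc_root hdep b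
    rw [← ih ht htb hsv]
    rcases hadj _ _ hab with h | h
    · exact Anc.root_unique (hru.trans h) htb hr ht
    · exact hru.root_unique (htb.trans h) hr ht

theorem Anc.reachable {G : SimpleGraph V} {par : V → Option V}
    (htree : ∀ u v, par v = some u → G.Adj u v) {u v : V} (h : Anc par u v) :
    G.Reachable u v := by
  induction h with
  | refl => exact .rfl
  | tail _ hbc ih => exact ih.trans (htree _ _ hbc).reachable

/-- Roots represent the components: climbing from any vertex reaches a root, and since adjacent
vertices are comparable the root is constant along walks. -/
theorem card_connectedComponent_eq {G : SimpleGraph V} {par : V → Option V} {dep : V → ℕ}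
    (hdep : ∀ u v, par v = some u → dep u < dep v)
    (htree : ∀ u v, par v = some u → G.Adj u v)
    (hadj : ∀ u v, G.Adj u v → Anc par u v ∨ Anc par v u) :
    Nat.card G.ConnectedComponent = {v | par v = none}.ncard := by
  rw [← Nat.card_coe_set_eq]
  symm
  refine Nat.card_eq_of_bijective (fun v : {v | par v = none} => G.connectedComponentMk v)
    ⟨?_, ?_⟩
  · rintro ⟨u, hu⟩ ⟨v, hv⟩ h
    exact Subtype.ext (root_eq_of_reachable hdep hadj (SimpleGraph.ConnectedComponent.exact h)
      hu hv .refl .refl)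
  · intro c
    induction c using SimpleGraph.ConnectedComponent.ind with
    | _ v =>
      obtain ⟨r, hr, hrv⟩ := exists_anc_root hdep v
      exact ⟨⟨r, hr⟩, SimpleGraph.ConnectedComponent.sound (hrv.reachable htree)⟩

/-- Send a vertex to the edge to its parent. Two vertices with the same edge would be parents of
each other, against the growth of `dep`. -/
theorem ncard_treeEdges {par : V → Option V} {dep : V → ℕ}
    (hdep : ∀ u v, par v = some u → dep u < dep v) :
    {e : Sym2 V | ∃ u v, par v = some u ∧ e = s(u, v)}.ncard = {v | par v ≠ none}.ncard := by
  symm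
  refine Set.ncard_congr (fun v hv => s((par v).get (Option.isSome_iff_ne_none.2 hv), v)) ?_ ?_ ?_
  · intro v hv
    exact ⟨_, v, (Option.some_get _).symm, rfl⟩
  · intro v w hv hw h
    obtain ⟨a, ha⟩ := Option.ne_none_iff_exists'.1 hv
    obtain ⟨b, hb⟩ := Option.ne_none_iff_exists'.1 hw
    simp only [ha, hb, Option.get_some, Sym2.eq_iff] at h
    rcases h with ⟨-, h⟩ | ⟨h1, h2⟩
    · exact h
    · subst h1 h2
      exact absurd (hdep _ _ ha) (hdep _ _ hb).not_gt
  · rintro e ⟨u, v, huv, rfl⟩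
    exact ⟨v, by simp [huv], by simp [huv]⟩

/-- The deepest vertex of a cycle would have two distinct neighbours on the cycle, both of smaller
depth. -/
theorem isAcyclic_of_depth {H : SimpleGraph V} (dep : V → ℕ)
    (hne : ∀ u v, H.Adj u v → dep u ≠ dep v)
    (huniq : ∀ u u' v, H.Adj u v → H.Adj u' v → dep u < dep v → dep u' < dep v → u = u') :
    H.IsAcyclic := by
  classical
  intro v c hc
  obtain ⟨x, hx, hmax⟩ := c.support.toFinset.exists_max_image dep ⟨v, by simp⟩
  rw [List.mem_toFinset] at hx
  have hc' := hc.rotate hx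
  have hmem : ∀ y ∈ (c.rotate x hx).support, dep y ≤ dep x := fun y hy =>
    hmax y (List.mem_toFinset.2 ((c.mem_support_rotate_iff x hx).1 hy))
  have hnil := hc'.not_nil
  have h1 := (c.rotate x hx).adj_snd hnil
  have h2 := (c.rotate x hx).adj_penultimate hnil
  refine hc'.snd_ne_penultimate (huniq _ _ x h1.symm h2 ?_ ?_)
  · exact lt_of_le_of_ne (hmem _ (SimpleGraph.Walk.getVert_mem_support _ _)) (hne _ _ h1.symm)
  · exact lt_of_le_of_ne (hmem _ (SimpleGraph.Walk.getVert_mem_support _ _)) (hne _ _ h2)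

/-- `par` is the parent function of a rooted spanning forest structure on the whole of `F`, along
which `dep` increases. -/
structure IsParentMap (F : SimpleGraph V) (par : V → Option V) (dep : V → ℕ) : Prop where
  adj_iff : ∀ u v, F.Adj u v ↔ par v = some u ∨ par u = some v
  depth_lt : ∀ u v, par v = some u → dep u < dep v

theorem IsParentMap.anc_of_adj {F : SimpleGraph V} {par : V → Option V} {dep : V → ℕ}
    (hF : IsParentMap F par dep) (u v : V) (h : F.Adj u v) : Anc par u v ∨ Anc par v u :=
  ((hF.adj_iff u v).1 h).imp .single .single

theorem IsParentMap.isAcyclic {F : SimpleGraph V} {par : V → Option V} {dep : V → ℕ}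
    (hF : IsParentMap F par dep) : F.IsAcyclic := by
  refine isAcyclic_of_depth dep (fun u v h => ?_) (fun u u' v h h' hu hu' => ?_)
  · rcases (hF.adj_iff u v).1 h with h | h
    · exact (hF.depth_lt _ _ h).ne
    · exact (hF.depth_lt _ _ h).ne'
  · have key : ∀ w, F.Adj w v → dep w < dep v → par v = some w := fun w hw hlt =>
      ((hF.adj_iff w v).1 hw).resolve_right fun h => (hF.depth_lt _ _ h).not_gt hlt
    exact Option.some_injective _ ((key u h hu).symm.trans (key u' h' hu'))

theorem restrict_adj {G : SimpleGraph V} {U : Set V} {u v : V} :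
    (restrict G U).Adj u v ↔ G.Adj u v ∧ u ∈ U ∧ v ∈ U := by
  simp [restrict]

theorem isAcyclic_induce_of_restrict {G : SimpleGraph V} {U : Set V}
    (h : (restrict G U).IsAcyclic) : (G.induce U).IsAcyclic :=
  h.comap ⟨Subtype.val, fun {a b} hab => restrict_adj.2 ⟨hab, a.2, b.2⟩⟩ Subtype.val_injective

/-- Every choice of one root in each component of a forest comes with a parent function. -/
theorem IsRooting.exists_isParentMap {G : SimpleGraph V} {U : Set V} {roots : List V}
    (hac : (restrict G U).IsAcyclic) (h : IsRooting G U roots) :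
    ∃ par dep, IsParentMap (restrict G U) par dep ∧ (∀ r ∈ roots, par r = none) ∧
      ∀ v ∈ U, ∃ r ∈ roots, Anc par r v := by
  classical
  set F := restrict G U with hF
  obtain ⟨-, hrU, hroot⟩ := h
  have hex : ∀ v, ∃ r, v ∈ U → r ∈ roots ∧ F.Reachable r v := fun v => by
    by_cases hv : v ∈ U
    · obtain ⟨r, hr, -⟩ := hroot v hv
      exact ⟨r, fun _ => hr⟩
    · exact ⟨v, fun h => absurd h hv⟩
  choose ρ hρ using hex
  have hρu : ∀ v ∈ U, ∀ r ∈ roots, F.Reachable r v → ρ v = r := fun v hv r hr hrv =>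
    (hroot v hv).unique (hρ v hv) ⟨hr, hrv⟩
  set dep : V → ℕ := fun v => F.dist (ρ v) v with hd
  have hadjρ : ∀ u v, F.Adj u v → ρ v = ρ u := fun u v huv => by
    have h' := restrict_adj.1 huv
    exact hρu v h'.2.2 _ (hρ u h'.2.1).1 ((hρ u h'.2.1).2.trans huv.reachable)
  have hne : ∀ u v, F.Adj u v → dep u ≠ dep v := fun u v huv => by
    have h' := restrict_adj.1 huv
    have := hac.dist_ne_of_adj huv (hρ u h'.2.1).2
    simpa [hd, hadjρ u v huv] using this
  have huniq : ∀ u v, F.Adj u v → dep u < dep v → ∀ u', F.Adj u' v → dep u' < dep v →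
      u = u' := by
    -- A shortest path from the root to `u`, extended by the edge `uv`, is a shortest path to `v`.
    -- Paths in a forest are unique, so its penultimate vertex `u` is determined by `v`.
    have key : ∀ u v, F.Adj u v → dep u < dep v → ∃ p : F.Walk (ρ v) v, p.IsPath ∧
        p.penultimate = u := fun u v huv hlt => by
      have h' := restrict_adj.1 huv
      have hr := (hρ u h'.2.1).2
      rw [← hadjρ u v huv] at hr
      obtain ⟨q, hq, hql⟩ := hr.exists_path_of_dist
      refine ⟨q.concat huv, ?_, by simp⟩
      refine SimpleGraph.Walk.isPath_of_length_eq_dist _ (le_antisymm ?_ (SimpleGraph.dist_le _))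
      rw [SimpleGraph.Walk.length_concat, hql]
      simp only [hd, ← hadjρ u v huv] at hlt
      exact hlt
    intro u v huv hlt u' hu'v hlt'
    obtain ⟨p, hp, rfl⟩ := key u v huv hlt
    obtain ⟨p', hp', rfl⟩ := key u' v hu'v hlt'
    have := (hac.subsingleton_path _ _).elim ⟨p, hp⟩ ⟨p', hp'⟩
    rw [Subtype.mk.injEq] at this
    rw [this]
  set par : V → Option V := fun v =>
    if h : ∃ u, F.Adj u v ∧ dep u < dep v then some h.choose else none with hpar
  have hparI : ∀ u v, par v = some u ↔ F.Adj u v ∧ dep u < dep v := fun u v => by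
    by_cases h : ∃ u, F.Adj u v ∧ dep u < dep v
    · simp only [hpar, dif_pos h, Option.some.injEq]
      refine ⟨fun he => he ▸ h.choose_spec, fun hu => ?_⟩
      exact huniq _ _ h.choose_spec.1 h.choose_spec.2 _ hu.1 hu.2
    · simp only [hpar, dif_neg h, reduceCtorEq, false_iff]
      exact fun hu => h ⟨u, hu⟩
  have hPM : IsParentMap F par dep := by
    refine ⟨fun u v => ?_, fun u v huv => ((hparI u v).1 huv).2⟩
    rw [hparI, hparI]
    refine ⟨fun huv => ?_, fun h => h.elim (·.1) (·.1.symm)⟩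
    exact (lt_or_gt_of_ne (hne u v huv)).imp (⟨huv, ·⟩) (⟨huv.symm, ·⟩)
  refine ⟨par, dep, hPM, fun r hr => ?_, fun v hv => ?_⟩
  · rw [Option.eq_none_iff_forall_ne_some]
    intro u hu
    have := ((hparI u r).1 hu).2
    rw [show dep r = 0 by simp [hd, hρu r (hrU r hr) r hr .rfl]] at this
    exact absurd this (Nat.not_lt_zero _)
  · refine ⟨ρ v, (hρ v hv).1, ?_⟩
    obtain ⟨r, hr, hrv⟩ := exists_anc_root hPM.depth_lt v
    have hρn : par (ρ v) = none := by
      rw [Option.eq_none_iff_forall_ne_some]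
      intro u hu
      have := ((hparI u _).1 hu).2
      rw [show dep (ρ v) = 0 by
        simp [hd, hρu _ (hrU _ (hρ v hv).1) _ (hρ v hv).1 .rfl]] at this
      exact absurd this (Nat.not_lt_zero _)
    have := root_eq_of_reachable hPM.depth_lt hPM.anc_of_adj (hρ v hv).2 hρn hr .refl hrv
    rwa [this]

end ParentMap
end KIndep
namespace KIndep

-- Depth-first search: comparability, back edges and marked vertices.

section DFS
variable {V : Type*}

/-- The list `l` is a chain of parents ending in a root. -/
def IsParentChain (par : V → Option V) : List V → Prop
  | [] => True
  | u :: rest => par u = rest.head? ∧ IsParentChain par rest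

theorem IsParentChain.congr {par par' : V → Option V} {l : List V}
    (h : IsParentChain par l) (hc : ∀ a ∈ l, par' a = par a) : IsParentChain par' l := by
  induction l with
  | nil => trivial
  | cons u rest ih =>
    exact ⟨(hc u (by simp)).trans h.1, ih h.2 fun a ha => hc a (by simp [ha])⟩

theorem IsParentChain.anc {par : V → Option V} {l : List V} {u : V}
    (h : IsParentChain par (u :: l)) : ∀ a ∈ u :: l, Anc par a u := by
  induction l generalizing u with
  | nil => simpa [Anc] using Relation.ReflTransGen.refl
  | cons b l ih =>
    intro a ha
    rcases List.mem_cons.1 ha with rfl | ha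
    · exact .refl
    · exact (ih h.2 a ha).tail h.1

/-- The invariants of depth-first search. -/
structure DFSInv (G : SimpleGraph V) (σ : DFSState V) : Prop where
  chain : IsParentChain σ.parent σ.stack
  stack_visited : ∀ u ∈ σ.stack, u ∈ σ.visited
  finished : ∀ u ∈ σ.visited, u ∉ σ.stack → ∀ w, G.Adj u w → w ∈ σ.visited
  unvisited : ∀ v, v ∉ σ.visited → σ.parent v = none
  tree : ∀ u v, σ.parent v = some u →
    G.Adj u v ∧ u ∈ σ.visited ∧ v ∈ σ.visited ∧ σ.depth v = σ.depth u + 1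
  comparable : ∀ u ∈ σ.visited, ∀ v ∈ σ.visited, G.Adj u v →
    Anc σ.parent u v ∨ Anc σ.parent v u

theorem DFSInv.depth_lt {G : SimpleGraph V} {σ : DFSState V} (h : DFSInv G σ) (u v : V)
    (huv : σ.parent v = some u) : σ.depth u < σ.depth v := by
  have := (h.tree u v huv).2.2.2
  omega

theorem DFSInv.init (G : SimpleGraph V) : DFSInv G (DFSState.init V) :=
  ⟨trivial, by simp [DFSState.init], by simp [DFSState.init], by simp [DFSState.init],
    by simp [DFSState.init], by simp [DFSState.init]⟩

/-- The crucial case is `descend`: a discovered vertex off the stack has all its neighbours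
discovered, so the discovered neighbours of the new vertex lie on the stack, and these are ancestors
of the current vertex. -/
theorem DFSInv.step {G : SimpleGraph V} {σ τ : DFSState V} (h : DFSInv G σ)
    (hs : DFSStep G σ τ) : DFSInv G τ := by
  classical
  cases hs with
  | root r hst hr =>
    have hpar : Function.update σ.parent r none = σ.parent := by
      rw [← h.unvisited r hr, Function.update_eq_self]
    -- With an empty stack every discovered vertex is finished, so no edge leads from the discovered
    -- part to the new root.
    have hclosed : ∀ u ∈ σ.visited, ∀ w, G.Adj u w → w ∈ σ.visited := fun u hu =>
      h.finished u hu (by simp [hst])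
    refine ⟨⟨by simp, trivial⟩, by simp, ?_, ?_, ?_, ?_⟩
    · intro u hu hur w huw
      rcases hu with rfl | hu
      · simp at hur
      · exact Or.inr (hclosed u hu w huw)
    · intro v hv
      simp only [hpar]
      exact h.unvisited v fun h' => hv (Or.inr h')
    · intro u v huv
      simp only [hpar] at huv
      obtain ⟨h1, h2, h3, h4⟩ := h.tree u v huv
      have hu : u ≠ r := fun h' => hr (h' ▸ h2)
      have hv : v ≠ r := fun h' => hr (h' ▸ h3)
      refine ⟨h1, Or.inr h2, Or.inr h3, ?_⟩
      simpa [Function.update_of_ne hu, Function.update_of_ne hv] using h4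
    · intro u hu v hv huv
      simp only [hpar]
      rcases hu with rfl | hu
      · rcases hv with rfl | hv
        · exact absurd huv G.irrefl
        · exact absurd (hclosed v hv u huv.symm) hr
      · rcases hv with rfl | hv
        · exact absurd (hclosed u hu v huv) hr
        · exact h.comparable u hu v hv huv
  | descend u w rest hst huw hw =>
    have hu : u ∈ σ.visited := h.stack_visited u (by simp [hst])
    have hne : ∀ a ∈ σ.visited, a ≠ w := fun a ha h' => hw (h' ▸ ha)
    have hupd : ∀ a ∈ σ.visited, Function.update σ.parent w (some u) a = σ.parent a :=
      fun a ha => Function.update_of_ne (hne a ha) _ _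
    have hmono : ∀ a b, Anc σ.parent a b → Anc (Function.update σ.parent w (some u)) a b :=
      fun a b hab => Relation.ReflTransGen.mono
        (fun c d hcd => (hupd d (h.tree c d hcd).2.2.1).trans hcd) _ _ hab
    have hanc : ∀ x ∈ σ.visited, G.Adj x w → Anc (Function.update σ.parent w (some u)) x w := by
      intro x hx hxw
      have hxs : x ∈ σ.stack := by
        by_contra hxs
        exact hw (h.finished x hx hxs w hxw)
      have hch := h.chain
      rw [hst] at hch hxs
      exact (hmono _ _ (hch.anc x hxs)).tail (by simp)
    refine ⟨⟨by simp, ?_⟩, ?_, ?_, ?_, ?_, ?_⟩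
    · rw [← hst]
      exact h.chain.congr fun a ha => hupd a (h.stack_visited a ha)
    · intro a ha
      rcases List.mem_cons.1 ha with rfl | ha
      · exact Or.inl rfl
      · exact Or.inr (h.stack_visited a (hst ▸ ha))
    · intro a ha has b hab
      rcases ha with rfl | ha
      · simp at has
      · refine Or.inr (h.finished a ha (fun h' => has ?_) b hab)
        exact List.mem_cons_of_mem _ (hst ▸ h')
    · intro v hv
      have hvw : v ≠ w := fun h' => hv (Or.inl h')
      simp only [Function.update_of_ne hvw]
      exact h.unvisited v fun h' => hv (Or.inr h')
    · intro a b hab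
      by_cases hb : b = w
      · subst hb
        simp only [Function.update_self, Option.some.injEq] at hab
        subst hab
        refine ⟨huw, Or.inr hu, Or.inl rfl, ?_⟩
        simp [Function.update_of_ne (hne _ hu)]
      · simp only [Function.update_of_ne hb] at hab
        obtain ⟨h1, h2, h3, h4⟩ := h.tree a b hab
        refine ⟨h1, Or.inr h2, Or.inr h3, ?_⟩
        simpa [Function.update_of_ne hb, Function.update_of_ne (hne _ h2)] using h4
    · intro a ha b hb hab
      rcases ha with rfl | ha
      · rcases hb with rfl | hb
        · exact absurd hab G.irrefl
        · exact Or.inr (hanc b hb hab.symm)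
      · rcases hb with rfl | hb
        · exact Or.inl (hanc a ha hab)
        · exact (h.comparable a ha b hb hab).imp (hmono _ _) (hmono _ _)
  | backtrack u rest hst hall =>
    have hch := h.chain
    rw [hst] at hch
    refine ⟨hch.2, fun a ha => h.stack_visited a (by simp [hst, ha]), ?_, h.unvisited, h.tree,
      h.comparable⟩
    intro a ha has b hab
    by_cases hau : a = u
    · exact hall b (hau ▸ hab)
    · exact h.finished a ha (by simp [hst, hau]; exact has) b hab

theorem DFSInv.of_reachable {G : SimpleGraph V} {σ : DFSState V}
    (h : Relation.ReflTransGen (DFSStep G) (DFSState.init V) σ) : DFSInv G σ := by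
  induction h with
  | refl => exact .init G
  | tail _ hs ih => exact ih.step hs

section Result
variable {G : SimpleGraph V} {D : DFSState V}

theorem IsDFSResult.comparable (h : IsDFSResult G D) (u v : V) (huv : G.Adj u v) :
    Anc D.parent u v ∨ Anc D.parent v u :=
  (DFSInv.of_reachable h.1).comparable u (h.2.2 u) v (h.2.2 v) huv

theorem IsDFSResult.depth_ne (h : IsDFSResult G D) (u v : V) (huv : G.Adj u v) :
    D.depth u ≠ D.depth v := by
  have hlt := (DFSInv.of_reachable h.1).depth_lt
  rcases h.comparable u v huv with h | h
  · exact (h.depth_lt hlt huv.ne).ne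
  · exact (h.depth_lt hlt huv.ne').ne'

/-- Back edges are the complement of the tree edges. The latter correspond to the vertices with a
parent, and the vertices without one correspond to the components. -/
theorem IsDFSResult.ncard_backEdges [Finite V] (h : IsDFSResult G D) :
    ((backEdges G D).ncard : ℤ) = cycleDim G := by
  have hI := DFSInv.of_reachable h.1
  have hsub : {e : Sym2 V | ∃ u v, D.parent v = some u ∧ e = s(u, v)} ⊆ G.edgeSet := by
    rintro _ ⟨u, v, huv, rfl⟩
    exact (hI.tree u v huv).1
  have hback : backEdges G D = G.edgeSet \ {e | ∃ u v, D.parent v = some u ∧ e = s(u, v)} := by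
    ext e
    induction e using Sym2.ind with
    | _ a b =>
      simp only [backEdges, IsBackEdge, Set.mem_ofPred_eq, Set.mem_sdiff, SimpleGraph.mem_edgeSet]
      constructor
      · rintro ⟨u, v, he, huv, h1, h2⟩
        rw [← SimpleGraph.mem_edgeSet, he]
        refine ⟨huv, ?_⟩
        rintro ⟨x, y, hxy, he'⟩
        rcases Sym2.eq_iff.1 he' with ⟨rfl, rfl⟩ | ⟨rfl, rfl⟩
        · exact h2 hxy
        · exact h1 hxy
      · rintro ⟨hab, hno⟩
        exact ⟨a, b, rfl, hab, fun h' => hno ⟨b, a, h', Sym2.eq_swap⟩,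
          fun h' => hno ⟨a, b, h', rfl⟩⟩
  have h1 := Set.ncard_sdiff_add_ncard_of_subset hsub (Set.toFinite _)
  rw [← hback, ncard_treeEdges hI.depth_lt] at h1
  have h2 := Set.ncard_add_ncard_compl {v | D.parent v = none}
  have h3 : {v | D.parent v = none}ᶜ = {v | D.parent v ≠ none} := rfl
  rw [h3] at h2
  have h4 := card_connectedComponent_eq (G := G) hI.depth_lt (fun u v h => (hI.tree u v h).1)
    h.comparable
  rw [cycleDim, h4, Nat.card_coe_set_eq]
  omega

theorem ncard_marked_le [Finite V] : (marked G D).ncard ≤ (backEdges G D).ncard := by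
  classical
  -- Map an edge to its deeper endpoint, which strict inequality of depths makes unique. The default
  -- `e.out.1` is never needed to reach a marked vertex.
  have hsub : marked G D ⊆ (fun e : Sym2 V => if h : ∃ u v, e = s(u, v) ∧ D.depth v < D.depth u
      then h.choose else e.out.1) '' backEdges G D := by
    rintro u ⟨v, huv, hlt⟩
    refine ⟨s(u, v), ⟨u, v, rfl, huv⟩, ?_⟩
    have hex : ∃ u' v', s(u, v) = s(u', v') ∧ D.depth v' < D.depth u' := ⟨u, v, rfl, hlt⟩
    simp only [dif_pos hex]
    obtain ⟨v', he, hlt'⟩ := hex.choose_spec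
    rcases Sym2.eq_iff.1 he with ⟨h1, -⟩ | ⟨h1, h2⟩
    · exact h1.symm
    · rw [← h1, ← h2] at hlt'
      exact absurd hlt hlt'.not_gt
  exact (Set.ncard_le_ncard hsub (Set.toFinite _)).trans (Set.ncard_image_le (Set.toFinite _))

open Classical in
/-- The parent function of the DFS forest, restricted to the induced subgraph on `U`. -/
noncomputable def restrictParent (D : DFSState V) (U : Set V) (v : V) : Option V :=
  if v ∈ U then (D.parent v).filter (· ∈ U) else none

theorem restrictParent_eq_some {U : Set V} {u v : V} :
    restrictParent D U v = some u ↔ D.parent v = some u ∧ u ∈ U ∧ v ∈ U := by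
  by_cases hv : v ∈ U
  · simp [restrictParent, hv, Option.filter_eq_some_iff]
  · simp [restrictParent, hv]

/-- On the unmarked vertices only tree edges are left. -/
theorem IsDFSResult.isParentMap (h : IsDFSResult G D) :
    IsParentMap (restrict G (marked G D)ᶜ) (restrictParent D (marked G D)ᶜ) D.depth := by
  have hI := DFSInv.of_reachable h.1
  refine ⟨fun u v => ?_, fun u v huv => hI.depth_lt u v (restrictParent_eq_some.1 huv).1⟩
  rw [restrict_adj, restrictParent_eq_some, restrictParent_eq_some]
  constructor
  · rintro ⟨huv, hu, hv⟩
    by_contra hno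
    push Not at hno
    have hback : IsBackEdge G D u v := ⟨huv, fun h' => hno.2 h' hv hu, fun h' => hno.1 h' hu hv⟩
    rcases lt_or_gt_of_ne (h.depth_ne u v huv) with hlt | hlt
    · exact hv ⟨u, ⟨huv.symm, hback.2.2, hback.2.1⟩, hlt⟩
    · exact hu ⟨v, hback, hlt⟩
  · rintro (⟨h1, h2, h3⟩ | ⟨h1, h2, h3⟩)
    · exact ⟨(hI.tree u v h1).1, h2, h3⟩
    · exact ⟨(hI.tree v u h1).1.symm, h3, h2⟩

theorem IsDFSResult.le_ncard_compl_marked [Fintype V] (h : IsDFSResult G D) :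
    (Fintype.card V : ℤ) - cycleDim G ≤ ((marked G D)ᶜ.ncard : ℤ) := by
  have h1 := ncard_marked_le (G := G) (D := D)
  have h2 := Set.ncard_add_ncard_compl (marked G D)
  have h3 := h.ncard_backEdges
  rw [Nat.card_eq_fintype_card] at h2
  omega

end Result
end DFS
end KIndep
namespace KIndep

-- Pruning: determinism, component sizes and the counting bound.

section PhaseB
variable {V : Type*}

/-- The value returned by a call whose subtotal is `s`. -/
def pruned (k s : ℕ) : ℕ := if k ≤ s then 0 else s

open Classical in
/-- `raw v` is the subtotal computed in the body of the call at `v`. -/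
def IsSubtotal [Fintype V] (par : V → Option V) (k : ℕ) (raw : V → ℕ) : Prop :=
  ∀ v, raw v = 1 + ∑ w with par w = some v, pruned k (raw w)

/-- Recursion from the leaves upwards: depths are bounded by some `N`, and `N - dep` drops from
parent to child. -/
theorem wellFounded_child [Finite V] {par : V → Option V} {dep : V → ℕ}
    (hdep : ∀ u v, par v = some u → dep u < dep v) :
    WellFounded fun w v => par w = some v := by
  obtain ⟨N, hN⟩ := (Set.finite_range dep).bddAbove
  refine Subrelation.wf (r := InvImage (· < ·) fun v => N - dep v) ?_ (InvImage.wf _ Nat.lt_wfRel.wf)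
  intro w v hwv
  have h1 := hdep v w hwv
  have h2 : dep w ≤ N := hN ⟨w, rfl⟩
  show N - dep w < N - dep v
  omega

theorem exists_isSubtotal [Fintype V] {par : V → Option V} {dep : V → ℕ}
    (hdep : ∀ u v, par v = some u → dep u < dep v) (k : ℕ) : ∃ raw, IsSubtotal par k raw := by
  classical
  have hwf := wellFounded_child hdep
  refine ⟨hwf.fix fun v ih => 1 + ∑ w ∈ (Finset.univ.filter fun w => par w = some v).attach,
    pruned k (ih w.1 (Finset.mem_filter.1 w.2).2), fun v => ?_⟩
  rw [hwf.fix_eq]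
  refine congrArg (1 + ·) ?_
  conv_rhs => rw [← Finset.sum_attach]

theorem anc_head_iff {par : V → Option V} {v x : V} :
    Anc par v x ↔ x = v ∨ ∃ w, par w = some v ∧ Anc par w x := by
  rw [Anc, Relation.ReflTransGen.cases_head_iff, eq_comm]

/-- The inner loop of the induction in `clp_iff`; the hypothesis `hws` is what that induction
supplies for the children. -/
theorem clpLoop_iff {F : SimpleGraph V} {par : V → Option V} {k : ℕ} {raw : V → ℕ} {v : V}
    {ws : List V} (hws : ∀ w ∈ ws, ∀ S S' s, Clp F k w (some v) S S' s ↔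
      S' = S \ {x | Anc par w x ∧ k ≤ raw x} ∧ s = pruned k (raw w)) (S S' : Set V) (s s' : ℕ) :
    ClpLoop F k v ws s S S' s' ↔ S' = S \ {x | (∃ w ∈ ws, Anc par w x) ∧ k ≤ raw x} ∧
      s' = s + (ws.map fun w => pruned k (raw w)).sum := by
  induction ws generalizing S s with
  | nil =>
    constructor
    · intro h
      cases h
      simp
    · rintro ⟨rfl, rfl⟩
      simpa using ClpLoop.nil v _ S
  | cons w ws ih =>
    have ih := ih fun w hw => hws w (List.mem_cons_of_mem _ hw)
    have hw := hws w (by simp)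
    have hset : (S \ {x | Anc par w x ∧ k ≤ raw x}) \ {x | (∃ w ∈ ws, Anc par w x) ∧ k ≤ raw x}
        = S \ {x | (∃ w' ∈ w :: ws, Anc par w' x) ∧ k ≤ raw x} := by
      ext x
      simp only [Set.mem_sdiff, Set.mem_ofPred_eq, List.mem_cons, exists_eq_or_imp]
      rw [and_assoc, or_and_right, not_or]
    have hsum : s + pruned k (raw w) + (ws.map fun w => pruned k (raw w)).sum =
        s + ((w :: ws).map fun w => pruned k (raw w)).sum := by
      simp [add_assoc]
    rw [← hset, ← hsum]
    constructor
    · rintro (_ | ⟨_, _, _, _, _, _, _, _, _, h1, h2⟩)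
      obtain ⟨rfl, rfl⟩ := (hw _ _ _).1 h1
      exact (ih _ _).1 h2
    · intro h
      exact .cons _ _ _ _ _ _ _ _ _ ((hw _ _ _).2 ⟨rfl, rfl⟩) ((ih _ _).2 h)

variable [Fintype V]

/-- The neighbours other than the parent are the children, and neither the sum of their values nor
the union of the removed sets depends on their order. The equivalence yields termination and
uniqueness of the result together. -/
theorem clp_iff {F : SimpleGraph V} {par : V → Option V} {dep : V → ℕ}
    (hF : IsParentMap F par dep) {k : ℕ} {raw : V → ℕ} (hraw : IsSubtotal par k raw) (v : V) :
    ∀ S S' s, Clp F k v (par v) S S' s ↔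
      S' = S \ {x | Anc par v x ∧ k ≤ raw x} ∧ s = pruned k (raw v) := by
  classical
  induction v using (wellFounded_child hF.depth_lt).induction with
  | _ v ih =>
  have hchild : ∀ w, F.Adj v w ∧ par v ≠ some w ↔ par w = some v := fun w => by
    rw [hF.adj_iff]
    refine ⟨fun h => h.1.resolve_right h.2, fun h => ⟨.inl h, fun h' => ?_⟩⟩
    exact (hF.depth_lt _ _ h).not_gt (hF.depth_lt _ _ h')
  have hloop : ∀ ws : List V, ws.Nodup → (∀ w, w ∈ ws ↔ F.Adj v w ∧ par v ≠ some w) →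
      ∀ S S' s, ClpLoop F k v ws 1 S S' s ↔
        S' = S \ {x | (∃ w, par w = some v ∧ Anc par w x) ∧ k ≤ raw x} ∧ s = raw v := by
    intro ws hnd hmem S S' s
    have hmem' : ∀ w, w ∈ ws ↔ par w = some v := fun w => (hmem w).trans (hchild w)
    rw [clpLoop_iff (par := par) (raw := raw)
      fun w hw S S' s => by rw [← (hmem' w).1 hw]; exact ih w ((hmem' w).1 hw) S S' s]
    have hsum : 1 + (ws.map fun w => pruned k (raw w)).sum = raw v := by
      rw [hraw v, ← List.sum_toFinset _ hnd]
      congr 1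
      refine Finset.sum_congr ?_ fun _ _ => rfl
      ext w
      simp [hmem']
    simp only [hmem', hsum]
  have hcut : ∀ S : Set V, k ≤ raw v →
      (S \ {x | (∃ w, par w = some v ∧ Anc par w x) ∧ k ≤ raw x}) \ {v} =
        S \ {x | Anc par v x ∧ k ≤ raw x} := by
    intro S hk
    ext x
    simp only [Set.mem_sdiff, Set.mem_ofPred_eq, Set.mem_singleton_iff, anc_head_iff (v := v)]
    by_cases hx : x = v
    · subst hx
      simp [hk]
    · simp [hx]
  have hkeep : ∀ S : Set V, raw v < k →
      (S \ {x | (∃ w, par w = some v ∧ Anc par w x) ∧ k ≤ raw x}) =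
        S \ {x | Anc par v x ∧ k ≤ raw x} := by
    intro S hk
    ext x
    simp only [Set.mem_sdiff, Set.mem_ofPred_eq, anc_head_iff (v := v)]
    by_cases hx : x = v
    · subst hx
      simp [hk.not_ge]
    · simp [hx]
  intro S S' s
  constructor
  · rintro (⟨_, _, ws, _, S₁, s₁, hnd, hmem, hl, hk⟩ | ⟨_, _, ws, _, _, _, hnd, hmem, hl, hk⟩)
    · obtain ⟨rfl, rfl⟩ := (hloop ws hnd hmem _ _ _).1 hl
      exact ⟨hcut S hk, by simp [pruned, hk]⟩
    · obtain ⟨rfl, rfl⟩ := (hloop ws hnd hmem _ _ _).1 hl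
      exact ⟨hkeep S hk, by simp [pruned, hk.not_ge]⟩
  · rintro ⟨rfl, rfl⟩
    have hnd := (Finset.univ.filter fun w => F.Adj v w ∧ par v ≠ some w).nodup_toList
    have hmem : ∀ w, w ∈ (Finset.univ.filter fun w => F.Adj v w ∧ par v ≠ some w).toList ↔
        F.Adj v w ∧ par v ≠ some w := by simp
    have hl := (hloop _ hnd hmem S _ _).2 ⟨rfl, rfl⟩
    rcases le_or_gt k (raw v) with hk | hk
    · rw [pruned, if_pos hk, ← hcut S hk]
      exact .cut _ _ _ _ _ _ hnd hmem hl hk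
    · rw [pruned, if_neg hk.not_ge, ← hkeep S hk]
      exact .keep _ _ _ _ _ _ hnd hmem hl hk

theorem pruneFrom_iff {F : SimpleGraph V} {par : V → Option V} {dep : V → ℕ}
    (hF : IsParentMap F par dep) {k : ℕ} {raw : V → ℕ} (hraw : IsSubtotal par k raw)
    {roots : List V} (hroots : ∀ r ∈ roots, par r = none) (S S' : Set V) :
    PruneFrom F k roots S S' ↔ S' = S \ {x | (∃ r ∈ roots, Anc par r x) ∧ k ≤ raw x} := by
  induction roots generalizing S with
  | nil =>
    constructor
    · intro h
      cases h
      simp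
    · rintro rfl
      simpa using PruneFrom.nil S
  | cons r rs ih =>
    have ih := ih fun w hw => hroots w (List.mem_cons_of_mem _ hw)
    have hr := clp_iff hF hraw r
    rw [hroots r (by simp)] at hr
    have hset : (S \ {x | Anc par r x ∧ k ≤ raw x}) \ {x | (∃ w ∈ rs, Anc par w x) ∧ k ≤ raw x}
        = S \ {x | (∃ w' ∈ r :: rs, Anc par w' x) ∧ k ≤ raw x} := by
      ext x
      simp only [Set.mem_sdiff, Set.mem_ofPred_eq, List.mem_cons, exists_eq_or_imp]
      rw [and_assoc, or_and_right, not_or]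
    rw [← hset]
    constructor
    · rintro (_ | ⟨_, _, _, _, _, _, h1, h2⟩)
      obtain ⟨rfl, rfl⟩ := (hr _ _ _).1 h1
      exact (ih _).1 h2
    · intro h
      exact .cons _ _ _ _ _ _ ((hr _ _ _).2 ⟨rfl, rfl⟩) ((ih _).2 h)

theorem phaseB_iff {G : SimpleGraph V} {U : Set V} {par : V → Option V} {dep : V → ℕ}
    (hF : IsParentMap (restrict G U) par dep) {k : ℕ} {raw : V → ℕ}
    (hraw : IsSubtotal par k raw) {roots : List V} (hroots : ∀ r ∈ roots, par r = none)
    (hcover : ∀ v ∈ U, ∃ r ∈ roots, Anc par r v) (S : Set V) :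
    PhaseB G k U roots S ↔ S = {x | x ∈ U ∧ raw x < k} := by
  rw [PhaseB, pruneFrom_iff hF hraw hroots]
  have : U \ {x | (∃ r ∈ roots, Anc par r x) ∧ k ≤ raw x} = {x | x ∈ U ∧ raw x < k} := by
    ext x
    simp only [Set.mem_sdiff, Set.mem_ofPred_eq, not_and, not_le]
    exact and_congr_right fun hx => ⟨fun h => h (hcover x hx), fun h _ => h⟩
  rw [this]

open Classical in
/-- In a set `P` of vertices closed under taking children, the vertices that are cut account for
`k` vertices each, on top of the values returned from `P`. -/
theorem IsSubtotal.count {par : V → Option V} {k : ℕ} {raw : V → ℕ}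
    (hraw : IsSubtotal par k raw) (P : Finset V) (hP : ∀ u ∈ P, ∀ w, par w = some u → w ∈ P) :
    k * (P.filter fun v => k ≤ raw v).card +
      ∑ w ∈ P with ¬ ∃ u ∈ P, par w = some u, pruned k (raw w) ≤ P.card := by
  -- Exchanging the sums, each vertex with a parent in `P` contributes its returned value once, to
  -- that parent.
  have h1 : ∑ v ∈ P, raw v = P.card + ∑ w ∈ P with ∃ u ∈ P, par w = some u, pruned k (raw w) := by
    rw [Finset.sum_congr rfl fun v _ => hraw v, Finset.sum_add_distrib, Finset.sum_const,
      smul_eq_mul, mul_one]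
    congr 1
    rw [← Finset.sum_biUnion]
    · refine Finset.sum_congr ?_ fun _ _ => rfl
      ext w
      simp only [Finset.mem_biUnion, Finset.mem_filter, Finset.mem_univ, true_and]
      exact ⟨fun ⟨u, hu, h⟩ => ⟨hP u hu w h, u, hu, h⟩, fun h => h.2⟩
    · intro u _ v _ huv
      rw [Function.onFun, Finset.disjoint_left]
      intro w hw hw'
      simp only [Finset.mem_filter, Finset.mem_univ, true_and] at hw hw'
      exact huv (Option.some_injective _ (hw.symm.trans hw'))
  -- A kept vertex returns its whole subtotal and a cut vertex loses it. Comparing with `h1`, the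
  -- values returned inside `P` cancel.
  have h2 : ∑ v ∈ P, raw v = ∑ v ∈ P, pruned k (raw v) + ∑ v ∈ P with k ≤ raw v, raw v := by
    rw [Finset.sum_filter, ← Finset.sum_add_distrib]
    refine Finset.sum_congr rfl fun v _ => ?_
    unfold pruned
    split_ifs <;> simp
  have h3 : k * (P.filter fun v => k ≤ raw v).card ≤ ∑ v ∈ P with k ≤ raw v, raw v := by
    rw [mul_comm, ← smul_eq_mul]
    exact Finset.card_nsmul_le_sum _ _ _ fun v hv => (Finset.mem_filter.1 hv).2
  have h4 := Finset.sum_filter_add_sum_filter_not P (fun w => ∃ u ∈ P, par w = some u)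
    fun w => pruned k (raw w)
  omega

/-- Apply `count` to the vertices strictly deeper than `v`: the children of `v` have no parent among
them, and `v` itself is left out. The bound keeps the machine's accumulators within a word. -/
theorem IsSubtotal.le_card {par : V → Option V} {dep : V → ℕ}
    (hdep : ∀ u v, par v = some u → dep u < dep v) {k : ℕ} {raw : V → ℕ}
    (hraw : IsSubtotal par k raw) (v : V) : raw v ≤ Fintype.card V := by
  classical
  have h := hraw.count (Finset.univ.filter fun w => dep v < dep w) (by
    intro u hu w hwu
    simp only [Finset.mem_filter, Finset.mem_univ, true_and] at hu ⊢
    exact hu.trans (hdep _ _ hwu))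
  have h1 : ∑ w with par w = some v, pruned k (raw w) ≤
      (Finset.univ.filter fun w => dep v < dep w).card := by
    refine (Finset.sum_le_sum_of_subset fun w hw => ?_).trans (le_of_add_le_right h)
    simp only [Finset.mem_filter, Finset.mem_univ, true_and] at hw ⊢
    refine ⟨hdep _ _ hw, ?_⟩
    rintro ⟨u, hu, hwu⟩
    obtain rfl : v = u := Option.some_injective _ (hw.symm.trans hwu)
    exact lt_irrefl _ hu
  have h2 : (Finset.univ.filter fun w => dep v < dep w).card < Fintype.card V :=
    Finset.card_lt_univ_of_notMem (x := v) (by simp)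
  rw [hraw v]
  convert (show 1 + ∑ w with par w = some v, pruned k (raw w) ≤ Fintype.card V by omega)

/-- The vertices connected to `v` from below after cutting. -/
def cluster (par : V → Option V) (k : ℕ) (raw : V → ℕ) (v : V) : Set V :=
  {x | Relation.ReflTransGen (fun a b => par b = some a ∧ raw b < k) v x}

/-- A child that is kept returns its full subtotal, which by induction bounds its own cluster; a
child that is cut starts no branch. -/
theorem ncard_cluster_le {par : V → Option V} {dep : V → ℕ}
    (hdep : ∀ u v, par v = some u → dep u < dep v) {k : ℕ} {raw : V → ℕ}
    (hraw : IsSubtotal par k raw) (v : V) : (cluster par k raw v).ncard ≤ raw v := by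
  classical
  induction v using (wellFounded_child hdep).induction with
  | _ v ih =>
  have hsub : cluster par k raw v ⊆ ↑(insert v
      ((Finset.univ.filter fun w => par w = some v ∧ raw w < k).biUnion
        fun w => (cluster par k raw w).toFinset)) := by
    intro x hx
    rcases Relation.ReflTransGen.cases_head hx with rfl | ⟨w, hw, hwx⟩
    · simp
    · simp only [Finset.coe_insert, Finset.coe_biUnion, Finset.coe_filter, Finset.mem_univ,
        true_and, Set.mem_insert_iff, Set.mem_iUnion]
      exact Or.inr ⟨w, hw, Finset.mem_coe.2 (Set.mem_toFinset.2 hwx)⟩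
  refine (Set.ncard_le_ncard hsub (Set.toFinite _)).trans ?_
  rw [Set.ncard_coe_finset, hraw v]
  refine (Finset.card_insert_le _ _).trans ?_
  rw [add_comm]
  refine Nat.add_le_add_left (Finset.card_biUnion_le.trans ?_) 1
  calc _ ≤ ∑ w with par w = some v ∧ raw w < k, pruned k (raw w) := by
        refine Finset.sum_le_sum fun w hw => ?_
        simp only [Finset.mem_filter, Finset.mem_univ, true_and] at hw
        rw [pruned, if_neg hw.2.not_ge, ← Set.ncard_eq_toFinset_card']
        exact ih w hw.1
    _ ≤ _ := by
        refine Finset.sum_le_sum_of_subset fun w hw => ?_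
        simp only [Finset.mem_filter, Finset.mem_univ, true_and] at hw ⊢
        exact hw.1

/-- Follow a walk from the shallowest vertex `t` of the component. A step down stays in the cluster
of `t`. A step up either returns to the previous vertex of the descending chain or leaves `t`
upwards, which minimality forbids. -/
theorem ncard_supp_le {G : SimpleGraph V} {U : Set V} {par : V → Option V} {dep : V → ℕ}
    (hF : IsParentMap (restrict G U) par dep) {k : ℕ} {raw : V → ℕ}
    (hraw : IsSubtotal par k raw) (c : (G.induce {x | x ∈ U ∧ raw x < k}).ConnectedComponent) :
    c.supp.ncard ≤ k - 1 := by
  classical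
  obtain ⟨t, ht, hmin⟩ := Set.exists_min_image c.supp (fun x => dep x.1) (Set.toFinite _)
    c.nonempty_supp
  have hsub : Subtype.val '' c.supp ⊆ cluster par k raw t.1 := by
    rintro _ ⟨x, hx, rfl⟩
    have hreach : (G.induce {x | x ∈ U ∧ raw x < k}).Reachable t x :=
      SimpleGraph.ConnectedComponent.exact (ht.trans hx.symm)
    rw [SimpleGraph.reachable_iff_reflTransGen] at hreach
    clear hx
    induction hreach with
    | refl => exact .refl
    | @tail a b hta hab ih =>
      have hab' : (restrict G U).Adj a.1 b.1 := restrict_adj.2 ⟨hab, a.2.1, b.2.1⟩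
      rcases (hF.adj_iff _ _).1 hab' with h | h
      · exact Relation.ReflTransGen.tail ih ⟨h, b.2.2⟩
      · rcases Relation.ReflTransGen.cases_tail ih with hat | ⟨a', ha', h'⟩
        · have hb : b ∈ c.supp := by
            have := (SimpleGraph.reachable_iff_reflTransGen _ _).2 (hta.tail hab)
            rw [SimpleGraph.ConnectedComponent.mem_supp_iff] at ht ⊢
            rw [← ht]
            exact (SimpleGraph.ConnectedComponent.sound this).symm
          have h1 := hmin b hb
          have h2 := hF.depth_lt _ _ h
          rw [hat] at h2
          exact absurd h1 h2.not_ge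
        · obtain rfl : b.1 = a' := Option.some_injective _ (h.symm.trans h'.1)
          exact ha'
  have h1 := Set.ncard_le_ncard hsub (Set.toFinite _)
  rw [Set.ncard_image_of_injective _ Subtype.val_injective] at h1
  have h2 := ncard_cluster_le hF.depth_lt hraw t.1
  have h3 : raw t.1 < k := t.2.2
  omega

theorem isGenIndep_of_ncard_supp_le {G : SimpleGraph V} {S : Set V} {k : ℕ} (hk : 1 ≤ k)
    (h : ∀ c : (G.induce S).ConnectedComponent, c.supp.ncard ≤ k - 1) : IsGenIndep G k S := by
  intro H hH
  obtain ⟨x⟩ := hH.connected.nonempty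
  have hsub : H.verts ⊆ ((G.induce S).connectedComponentMk x.1).supp := by
    intro y hy
    rw [SimpleGraph.ConnectedComponent.mem_supp_iff]
    exact SimpleGraph.ConnectedComponent.sound
      ((hH.connected.preconnected ⟨y, hy⟩ x).map H.hom)
  have h1 := Set.ncard_le_ncard hsub (Set.toFinite _)
  have h2 := h ((G.induce S).connectedComponentMk x.1)
  omega

/-- `count` with `P = U`, discarding the values returned by the roots: `k` times the number of cut
vertices is at most `|U|`. -/
theorem IsSubtotal.mul_ncard_le {par : V → Option V} {k : ℕ} {raw : V → ℕ}
    (hraw : IsSubtotal par k raw) {U : Set V} (hU : ∀ u w, par w = some u → w ∈ U) :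
    (k - 1) * U.ncard ≤ k * {x | x ∈ U ∧ raw x < k}.ncard := by
  classical
  have h := hraw.count U.toFinset fun u _ w hw => Set.mem_toFinset.2 (hU u w hw)
  have h1 : {x | x ∈ U ∧ raw x < k}.ncard = (U.toFinset.filter fun x => ¬ k ≤ raw x).card := by
    rw [← Set.ncard_coe_finset]
    congr 1
    ext x
    simp
  have h2 := Finset.card_filter_add_card_filter_not (s := U.toFinset) fun x => k ≤ raw x
  rw [h1, Set.ncard_eq_toFinset_card']
  set a := (U.toFinset.filter fun x => k ≤ raw x).card
  set b := (U.toFinset.filter fun x => ¬ k ≤ raw x).card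
  rw [← h2] at h ⊢
  have h' := le_of_add_le_left h
  rw [Nat.sub_mul, mul_add]
  omega

theorem ceil_le_of_mul_le {k u s : ℕ} {a : ℤ} (hk : 1 ≤ k) (hu : a ≤ u)
    (h : (k - 1) * u ≤ k * s) : ⌈(((k : ℚ) - 1) / k) * (a : ℚ)⌉ ≤ (s : ℤ) := by
  rw [Int.ceil_le]
  have hk' : (1 : ℚ) ≤ k := by exact_mod_cast hk
  have hu' : (a : ℚ) ≤ u := by exact_mod_cast hu
  have h' : ((k : ℚ) - 1) * u ≤ k * s := by
    have : (((k - 1 : ℕ) : ℚ)) * u ≤ k * s := by exact_mod_cast h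
    rwa [Nat.cast_sub hk, Nat.cast_one] at this
  rw [div_mul_eq_mul_div, div_le_iff₀ (by linarith)]
  calc ((k : ℚ) - 1) * a ≤ (k - 1) * u := mul_le_mul_of_nonneg_left hu' (by linarith)
    _ ≤ k * s := h'
    _ = _ := by push_cast; ring

/-- Correctness of every run of the two phases. -/
theorem IsDFSResult.phaseB_correct {G : SimpleGraph V} {k : ℕ} (hk : 2 ≤ k) {D : DFSState V}
    (hD : IsDFSResult G D) {roots : List V} (hr : IsRooting G (marked G D)ᶜ roots) :
    (∃ S, PhaseB G k (marked G D)ᶜ roots S) ∧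
      ∀ S, PhaseB G k (marked G D)ᶜ roots S →
        S ⊆ (marked G D)ᶜ ∧
        (∀ c : (G.induce S).ConnectedComponent, c.supp.ncard ≤ k - 1) ∧
        IsGenIndep G k S ∧
        ⌈(((k : ℚ) - 1) / k) * ((Fintype.card V : ℚ) - (cycleDim G : ℚ))⌉ ≤ (S.ncard : ℤ) := by
  obtain ⟨par, dep, hF, hroots, hcover⟩ := hr.exists_isParentMap hD.isParentMap.isAcyclic
  obtain ⟨raw, hraw⟩ := exists_isSubtotal hF.depth_lt k
  have hiff := phaseB_iff hF hraw hroots hcover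
  refine ⟨⟨_, (hiff _).2 rfl⟩, fun S hS => ?_⟩
  obtain rfl := (hiff S).1 hS
  have hc := ncard_supp_le hF hraw
  refine ⟨fun x hx => hx.1, hc, isGenIndep_of_ncard_supp_le (by omega) hc, ?_⟩
  have := ceil_le_of_mul_le (by omega) hD.le_ncard_compl_marked (hraw.mul_ncard_le
    fun u w h => (restrict_adj.1 ((hF.adj_iff u w).2 (.inl h))).2.2)
  push_cast at this
  exact this

end PhaseB
end KIndep
namespace KIndep

-- Running time of loop-free programs and of single loops.

section Machine

/-- The number of instructions and tests in a program. -/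
def Cmd.size : Cmd → ℕ
  | .seq p q => p.size + q.size
  | .ifLt _ _ p q => p.size + q.size + 1
  | .whileLt _ _ p => p.size + 1
  | _ => 1

/-- A precondition for the loop-free program to reach the postcondition `Q` with all numbers
bounded by `W`. -/
def Cmd.wp (W : ℕ) : Cmd → (Mem → Prop) → Mem → Prop
  | .skip, Q, s => Q s
  | .const x c, Q, s => c ≤ W ∧ Q (s.setReg x c)
  | .move x y, Q, s => Q (s.setReg x (s.reg y))
  | .add x y z, Q, s => s.reg y + s.reg z ≤ W ∧ Q (s.setReg x (s.reg y + s.reg z))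
  | .sub x y z, Q, s => Q (s.setReg x (s.reg y - s.reg z))
  | .load x a i, Q, s => Q (s.setReg x (s.arr a (s.reg i)))
  | .store a i x, Q, s => Q (s.setArr a (s.reg i) (s.reg x))
  | .seq p q, Q, s => p.wp W (q.wp W Q) s
  | .ifLt x y p q, Q, s =>
    (s.reg x < s.reg y → p.wp W Q s) ∧ (¬ s.reg x < s.reg y → q.wp W Q s)
  | .whileLt _ _ _, _, _ => False

/-- Without loops every instruction and test is executed at most once, so the size bounds the time.
-/
theorem Cmd.exec_of_wp {W : ℕ} (p : Cmd) {Q : Mem → Prop} {s : Mem} (h : p.wp W Q s) :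
    ∃ t s', t ≤ p.size ∧ Exec W p s t s' ∧ Q s' := by
  induction p generalizing s Q with
  | skip => exact ⟨1, s, le_rfl, .skip s, h⟩
  | const x c => exact ⟨1, _, le_rfl, .const s x c h.1, h.2⟩
  | move x y => exact ⟨1, _, le_rfl, .move s x y, h⟩
  | add x y z => exact ⟨1, _, le_rfl, .add s x y z h.1, h.2⟩
  | sub x y z => exact ⟨1, _, le_rfl, .sub s x y z, h⟩
  | load x a i => exact ⟨1, _, le_rfl, .load s x a i, h⟩
  | store a i x => exact ⟨1, _, le_rfl, .store s a i x, h⟩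
  | seq p q ihp ihq =>
    obtain ⟨t, s', ht, he, h'⟩ := ihp h
    obtain ⟨t', s'', ht', he', h''⟩ := ihq h'
    exact ⟨t + t', s'', Nat.add_le_add ht ht', .seq _ _ _ _ _ _ _ he he', h''⟩
  | ifLt x y p q ihp ihq =>
    by_cases hlt : s.reg x < s.reg y
    · obtain ⟨t, s', ht, he, h'⟩ := ihp (h.1 hlt)
      exact ⟨t + 1, s', by simp only [Cmd.size]; omega, .ifTrue _ _ _ _ _ _ _ hlt he, h'⟩
    · obtain ⟨t, s', ht, he, h'⟩ := ihq (h.2 hlt)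
      exact ⟨t + 1, s', by simp only [Cmd.size]; omega, .ifFalse _ _ _ _ _ _ _ hlt he, h'⟩
  | whileLt => exact h.elim

/-- A loop with a loop-free body, an invariant and a decreasing potential. -/
theorem exec_whileLt {W x y : ℕ} {p : Cmd} (I : ℕ → Mem → Prop)
    (hstep : ∀ N s, I N s → s.reg x < s.reg y → p.wp W (fun s' => ∃ N' < N, I N' s') s)
    {N : ℕ} {s : Mem} (h : I N s) :
    ∃ t s', t ≤ (p.size + 1) * N + 1 ∧ Exec W (.whileLt x y p) s t s' ∧
      (∃ N', I N' s') ∧ ¬ s'.reg x < s'.reg y := by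
  induction N using Nat.strong_induction_on generalizing s with
  | _ N ih =>
    by_cases hlt : s.reg x < s.reg y
    · obtain ⟨t, s', ht, he, N', hN', h'⟩ := p.exec_of_wp (hstep N s h hlt)
      obtain ⟨t', s'', ht', he', h''⟩ := ih N' hN' h'
      refine ⟨t + t' + 1, s'', ?_, .whileTrue _ _ _ _ _ _ _ _ hlt he he', h''⟩
      -- One round costs the body and one test, paid for by a drop of at least 1 in the potential;
      -- the extra 1 in the bound is the final failing test.
      have := Nat.mul_le_mul_left (p.size + 1) (Nat.succ_le_of_lt hN')
      rw [Nat.mul_succ] at this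
      omega
    · exact ⟨1, s, Nat.le_add_left _ _, .whileFalse _ _ _ _ hlt, ⟨N, h⟩, hlt⟩

end Machine

-- The adjacency lists in memory and their total length.

section Input

theorem getElem?_flatMap {α β : Type*} (f : α → List β) (l : List α) (i : ℕ) (hi : i < l.length)
    (j : ℕ) (hj : j < (f l[i]).length) :
    (l.flatMap f)[((l.take i).map fun a => (f a).length).sum + j]? = some (f l[i])[j] := by
  induction l generalizing i with
  | nil => simp at hi
  | cons a l ih =>
    cases i with
    | zero =>
      simp only [List.getElem_cons_zero] at hj
      simp [List.getElem?_append_left hj]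
    | succ i =>
      simp only [List.getElem_cons_succ] at hj ⊢
      rw [List.flatMap_cons, List.take_succ_cons, List.map_cons, List.sum_cons, add_assoc,
        List.getElem?_append_right (Nat.le_add_right _ _), Nat.add_sub_cancel_left]
      exact ih i (by simpa using hi) hj

variable {n : ℕ} (nb : Fin n → List (Fin n))

/-- The offset of the adjacency list of vertex number `i`. -/
def offset (i : ℕ) : ℕ := (((List.finRange n).take i).map fun v => (nb v).length).sum

theorem offset_succ (v : Fin n) : offset nb (v + 1) = offset nb v + (nb v).length := by
  have hv : (v : ℕ) < (List.finRange n).length := by simp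
  rw [offset, List.take_add_one, List.getElem?_eq_getElem hv]
  simp [offset]

theorem offset_le (i : ℕ) : offset nb i ≤ ∑ v, (nb v).length := by
  rw [Fin.sum_univ_def]
  exact ((List.take_sublist _ _).map _).sum_le_sum (by simp)

theorem inputMem_arr_one (k : ℕ) (v : Fin n) (j : ℕ) (hj : j < (nb v).length) :
    (inputMem k nb).arr 1 (offset nb v + j) = ((nb v)[j] : ℕ) := by
  have hv : (v : ℕ) < (List.finRange n).length := by simp
  have h := getElem?_flatMap nb (List.finRange n) v hv j (by simpa using hj)
  simp only [inputMem, List.getD_eq_getElem?_getD, List.getElem?_map, offset, one_ne_zero,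
    if_false, if_true, h]
  simp

theorem sum_length_eq {G : SimpleGraph (Fin n)} (h : IsAdjList G nb) :
    ∑ v, (nb v).length = 2 * G.edgeSet.ncard := by
  classical
  rw [Set.ncard_eq_toFinset_card', Set.toFinset_card, ← SimpleGraph.edgeFinset_card,
    ← SimpleGraph.sum_degrees_eq_twice_card_edges]
  refine Finset.sum_congr rfl fun v _ => ?_
  rw [← List.toFinset_card_of_nodup (h v).1, ← SimpleGraph.card_neighborFinset_eq_degree]
  congr 1
  ext w
  simp [(h v).2]

end Input
end KIndep
namespace KIndep

-- Memory updates and the program for Phase A.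

section Memory

theorem Mem.reg_setReg (s : Mem) (x v y : ℕ) :
    (s.setReg x v).reg y = if y = x then v else s.reg y := by
  simp [Mem.setReg, Function.update_apply]

theorem Mem.arr_setReg (s : Mem) (x v : ℕ) : (s.setReg x v).arr = s.arr := rfl

theorem Mem.reg_setArr (s : Mem) (a i v : ℕ) : (s.setArr a i v).reg = s.reg := rfl

theorem Mem.arr_setArr (s : Mem) (a i v b j : ℕ) :
    (s.setArr a i v).arr b j = if b = a then (if j = i then v else s.arr b j) else s.arr b j := by
  simp only [Mem.setArr, Function.update_apply]
  split_ifs <;> simp_all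

/-- Sequential composition of a list of programs. -/
def Cmd.block : List Cmd → Cmd
  | [] => .skip
  | p :: l => .seq p (Cmd.block l)

/-- Discover the vertex in register `9`, with the code of its parent in register `15` and its depth
in register `12`. -/
def visitCmd : Cmd := .block
  [.store 2 9 15, .store 3 9 12, .store 6 9 5, .load 16 0 9, .store 7 9 16, .store 8 4 9,
    .add 4 4 5, .add 2 9 5]

/-- Scan the neighbour in register `9` of the vertex in register `6`. -/
def scanCmd : Cmd := .block
  [.add 7 7 5, .store 7 6 7, .load 12 3 6, .load 13 3 9,
    -- The neighbour is shallower. Mark the current vertex unless the code of its parent equals that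
    -- of the neighbour; inequality is tested by two strict comparisons.
    .ifLt 13 12
      (.block [.load 14 2 6, .add 9 9 5,
        .ifLt 14 9 (.store 4 6 5) (.ifLt 9 14 (.store 4 6 5) .skip)])
      .skip]

/-- One step of depth-first search. Register `2` holds the code of the current vertex, register `3`
the next candidate for a root, and register `4` the number of discovered vertices. -/
def dfsBody : Cmd :=
  -- Register 11 is never written and stays 0, so this asks whether there is a current vertex.
  .ifLt 11 2
    -- Register 2 holds `u + 1`, which is also the index of the offset at which the list of `u`
    -- ends.
    (.block [.sub 6 2 5, .load 7 7 6, .load 8 0 2,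
      .ifLt 7 8
        (.block [.load 9 1 7, .load 10 6 9,
          .ifLt 10 5 (.block [.move 15 2, .load 12 3 6, .add 12 12 5, visitCmd]) scanCmd])
        (.load 2 2 6)])
    (.block [.load 10 6 3,
      .ifLt 10 5 (.block [.move 9 3, .const 15 0, .const 12 0, visitCmd]) (.add 3 3 5)])

/-- Depth-first search with marking. -/
def dfsCmd : Cmd := .seq (.const 5 1) (.whileLt 3 0 dfsBody)

end Memory

-- The memory as a representation of a search configuration, and its potential.

section Simulation
variable {n : ℕ}

/-- The number that stands for an optional vertex. -/
def code (o : Option (Fin n)) : ℕ := o.elim 0 fun u => (u : ℕ) + 1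

theorem code_some (u : Fin n) : code (some u) = u + 1 := rfl

theorem code_none : code (none : Option (Fin n)) = 0 := rfl

/-- The memory `s` represents the configuration `σ` of depth-first search; `q v` neighbours of `v`
have been scanned, and `v` is number `pos v` in the order of discovery. -/
structure DFSRep (G : SimpleGraph (Fin n)) (k : ℕ) (nb : Fin n → List (Fin n)) (s : Mem)
    (σ : DFSState (Fin n)) (q pos : Fin n → ℕ) : Prop where
  reach : Relation.ReflTransGen (DFSStep G) (DFSState.init (Fin n)) σ
  reg0 : s.reg 0 = n
  reg1 : s.reg 1 = k
  reg5 : s.reg 5 = 1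
  reg11 : s.reg 11 = 0
  arr0 : ∀ i, s.arr 0 i = offset nb i
  arr1 : ∀ (v : Fin n) (j : ℕ) (hj : j < (nb v).length),
    s.arr 1 (offset nb v + j) = ((nb v)[j] : ℕ)
  arr5 : ∀ i, s.arr 5 i = 0
  arr9 : ∀ i, s.arr 9 i = 0
  cur : s.reg 2 = code σ.stack.head?
  parent : ∀ v : Fin n, s.arr 2 v = code (σ.parent v)
  depth : ∀ v : Fin n, s.arr 3 v = σ.depth v
  visited : ∀ v : Fin n, v ∈ σ.visited → s.arr 6 v = 1
  unvisited : ∀ v : Fin n, v ∉ σ.visited → s.arr 6 v = 0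
  idx_le : s.reg 3 ≤ n
  idx : ∀ v : Fin n, (v : ℕ) < s.reg 3 → v ∈ σ.visited
  idx_stack : s.reg 3 = n → σ.stack = []
  ptr : ∀ v ∈ σ.visited, s.arr 7 v = offset nb v + q v
  q_le : ∀ v ∈ σ.visited, q v ≤ (nb v).length
  q_finished : ∀ v ∈ σ.visited, v ∉ σ.stack → q v = (nb v).length
  scanned : ∀ v ∈ σ.visited, ∀ (j : ℕ) (hj : j < (nb v).length), j < q v →
    (nb v)[j] ∈ σ.visited ∧
      (σ.depth (nb v)[j] < σ.depth v → σ.parent v ≠ some (nb v)[j] → s.arr 4 v = 1)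
  mark_cases : ∀ v : Fin n, s.arr 4 v = 0 ∨ s.arr 4 v = 1
  mark : ∀ v : Fin n, s.arr 4 v = 1 → v ∈ σ.visited ∧
    ∃ w ∈ σ.visited, G.Adj v w ∧ σ.depth w < σ.depth v ∧ σ.parent v ≠ some w
  pos_lt : ∀ v ∈ σ.visited, pos v < s.reg 4
  order : ∀ v ∈ σ.visited, s.arr 8 (pos v) = v
  pos_surj : ∀ j < s.reg 4, ∃ v ∈ σ.visited, pos v = j
  pos_parent : ∀ u v, σ.parent v = some u → pos u < pos v
  depth_le : ∀ v ∈ σ.visited, σ.depth v ≤ pos v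

variable {G : SimpleGraph (Fin n)} {k : ℕ} {nb : Fin n → List (Fin n)} {s s' : Mem}
  {σ σ' : DFSState (Fin n)} {q pos : Fin n → ℕ}

/-- By `pos_surj` the discovery numbers below the counter are all attained on discovered vertices,
so the counter is at most the number of these. -/
theorem DFSRep.count_le (h : DFSRep G k nb s σ q pos) :
    s.reg 4 ≤ n ∧ ∀ w, w ∉ σ.visited → s.reg 4 < n := by
  classical
  have key : ∀ A : Finset (Fin n), (∀ v ∈ σ.visited, v ∈ A) → s.reg 4 ≤ A.card := by
    intro A hA
    have : Finset.range (s.reg 4) ⊆ A.image pos := by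
      intro j hj
      obtain ⟨v, hv, rfl⟩ := h.pos_surj j (Finset.mem_range.1 hj)
      exact Finset.mem_image_of_mem _ (hA v hv)
    simpa using (Finset.card_le_card this).trans Finset.card_image_le
  refine ⟨by simpa using key Finset.univ fun v _ => Finset.mem_univ v, fun w hw => ?_⟩
  have h1 := key (Finset.univ.erase w) fun v hv =>
    Finset.mem_erase.2 ⟨fun h' => hw (h' ▸ hv), Finset.mem_univ v⟩
  rw [Finset.card_erase_of_mem (Finset.mem_univ w), Finset.card_univ, Fintype.card_fin] at h1
  have := w.pos
  omega

/-- Treats the steps `root` and `descend` at once, with `o` and `d` the parent and depth of the new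
vertex. Data of discovered vertices are not altered, so the facts already recorded about scanned
edges persist. -/
theorem DFSRep.visit (h : DFSRep G k nb s σ q pos) {w : Fin n} (hw : w ∉ σ.visited)
    (hidx : s.reg 3 < n) {o : Option (Fin n)} {d : ℕ} (hstep : DFSStep G σ σ')
    (hpar : ∀ v, σ'.parent v = if v = w then o else σ.parent v)
    (hdep : ∀ v, σ'.depth v = if v = w then d else σ.depth v)
    (hvis : ∀ v, v ∈ σ'.visited ↔ v = w ∨ v ∈ σ.visited)
    (hst : σ'.stack = w :: σ.stack)
    (ho : ∀ u, o = some u → u ∈ σ.visited) (hd : d ≤ s.reg 4)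
    (hr : ∀ x, x = 0 ∨ x = 1 ∨ x = 3 ∨ x = 5 ∨ x = 11 → s'.reg x = s.reg x)
    (hr2 : s'.reg 2 = w + 1) (hr4 : s'.reg 4 = s.reg 4 + 1)
    (ha : ∀ a i, a = 0 ∨ a = 1 ∨ a = 4 ∨ a = 5 ∨ a = 9 → s'.arr a i = s.arr a i)
    (ha2 : ∀ i, s'.arr 2 i = if i = w then code o else s.arr 2 i)
    (ha3 : ∀ i, s'.arr 3 i = if i = w then d else s.arr 3 i)
    (ha6 : ∀ i, s'.arr 6 i = if i = w then 1 else s.arr 6 i)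
    (ha7 : ∀ i, s'.arr 7 i = if i = w then offset nb w else s.arr 7 i)
    (ha8 : ∀ i, s'.arr 8 i = if i = s.reg 4 then (w : ℕ) else s.arr 8 i) :
    DFSRep G k nb s' σ' (Function.update q w 0) (Function.update pos w (s.reg 4)) := by
  have hI := DFSInv.of_reachable h.reach
  have hne : ∀ v ∈ σ.visited, v ≠ w := fun v hv h' => hw (h' ▸ hv)
  have hne' : ∀ v ∈ σ.visited, (v : ℕ) ≠ w := fun v hv h' => hne v hv (Fin.ext h')
  have hcases : ∀ v ∈ σ'.visited, v = w ∨ v ≠ w ∧ v ∈ σ.visited := fun v hv =>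
    ((hvis v).1 hv).imp_right fun h => ⟨hne v h, h⟩
  refine ⟨h.reach.tail hstep, (hr 0 (by simp)).trans h.reg0, (hr 1 (by simp)).trans h.reg1,
    (hr 5 (by simp)).trans h.reg5, (hr 11 (by simp)).trans h.reg11,
    fun i => (ha 0 i (by simp)).trans (h.arr0 i),
    fun v j hj => (ha 1 _ (by simp)).trans (h.arr1 v j hj),
    fun i => (ha 5 i (by simp)).trans (h.arr5 i), fun i => (ha 9 i (by simp)).trans (h.arr9 i),
    by rw [hr2, hst]; rfl, ?_, ?_, ?_, ?_, (hr 3 (by simp)).trans_le h.idx_le, ?_, ?_, ?_, ?_, ?_,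
    ?_, ?_, ?_, ?_, ?_, ?_, ?_, ?_⟩
  · intro v
    rw [ha2, hpar, h.parent]
    by_cases hv : v = w
    · simp [hv]
    · simp [hv, Fin.val_inj]
  · intro v
    rw [ha3, hdep, h.depth]
    by_cases hv : v = w
    · simp [hv]
    · simp [hv, Fin.val_inj]
  · intro v hv
    rw [ha6]
    rcases hcases v hv with rfl | ⟨-, hv⟩
    · simp
    · rw [if_neg (hne' v hv), h.visited v hv]
  · intro v hv
    rw [hvis, not_or] at hv
    rw [ha6, if_neg (fun h' => hv.1 (Fin.ext h')), h.unvisited v hv.2]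
  · intro v hv
    rw [hr 3 (by simp)] at hv
    exact (hvis v).2 (.inr (h.idx v hv))
  · intro h'
    rw [hr 3 (by simp)] at h'
    omega
  · intro v hv
    rw [ha7]
    rcases hcases v hv with rfl | ⟨hvw, hv⟩
    · simp
    · rw [if_neg (hne' v hv), Function.update_of_ne hvw, h.ptr v hv]
  · intro v hv
    rcases hcases v hv with rfl | ⟨hvw, hv⟩
    · simp
    · rw [Function.update_of_ne hvw]
      exact h.q_le v hv
  · intro v hv hvs
    rw [hst, List.mem_cons, not_or] at hvs
    rcases hcases v hv with rfl | ⟨hvw, hv⟩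
    · exact absurd rfl hvs.1
    · rw [Function.update_of_ne hvw]
      exact h.q_finished v hv hvs.2
  · intro v hv j hj hjq
    rcases hcases v hv with rfl | ⟨hvw, hv⟩
    · simp at hjq
    · rw [Function.update_of_ne hvw] at hjq
      obtain ⟨h1, h2⟩ := h.scanned v hv j hj hjq
      rw [hdep, hdep, hpar, if_neg hvw, if_neg hvw, if_neg (hne _ h1), ha 4 _ (by simp)]
      exact ⟨(hvis _).2 (.inr h1), h2⟩
  · intro v
    rw [ha 4 _ (by simp)]
    exact h.mark_cases v
  · intro v hv
    rw [ha 4 _ (by simp)] at hv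
    obtain ⟨h1, x, h2, h3, h4, h5⟩ := h.mark v hv
    refine ⟨(hvis _).2 (.inr h1), x, (hvis _).2 (.inr h2), h3, ?_⟩
    rw [hdep, hdep, hpar, if_neg (hne _ h1), if_neg (hne _ h2), if_neg (hne _ h1)]
    exact ⟨h4, h5⟩
  · intro v hv
    rw [hr4]
    rcases hcases v hv with rfl | ⟨hvw, hv⟩
    · simp
    · rw [Function.update_of_ne hvw]
      exact (h.pos_lt v hv).trans (Nat.lt_succ_self _)
  · intro v hv
    rw [ha8]
    rcases hcases v hv with rfl | ⟨hvw, hv⟩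
    · simp
    · rw [Function.update_of_ne hvw, if_neg (h.pos_lt v hv).ne, h.order v hv]
  · intro j hj
    rw [hr4] at hj
    rcases Nat.lt_succ_iff_lt_or_eq.1 hj with hj | rfl
    · obtain ⟨v, hv, rfl⟩ := h.pos_surj j hj
      exact ⟨v, (hvis _).2 (.inr hv), Function.update_of_ne (hne v hv) _ _⟩
    · exact ⟨w, (hvis _).2 (.inl rfl), by simp⟩
  · intro u v huv
    rw [hpar] at huv
    split_ifs at huv with hvw
    · subst hvw
      have hu := ho u huv
      rw [Function.update_of_ne (hne u hu), Function.update_self]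
      exact h.pos_lt u hu
    · have hu := (hI.tree u v huv).2.1
      rw [Function.update_of_ne (hne u hu), Function.update_of_ne hvw]
      exact h.pos_parent u v huv
  · intro v hv
    rw [hdep]
    rcases hcases v hv with rfl | ⟨hvw, hv⟩
    · simpa using hd
    · rw [Function.update_of_ne hvw, if_neg hvw]
      exact h.depth_le v hv

/-- No abstract step corresponds to this: only the pointer of `u` moves. The decision on the mark
can be made now, because the depths and parents of both endpoints are final. -/
theorem DFSRep.scan (h : DFSRep G k nb s σ q pos) (hadj : IsAdjList G nb) {u : Fin n}
    (hu : u ∈ σ.stack) (hq : q u < (nb u).length) (hw : (nb u)[q u] ∈ σ.visited)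
    (hr : ∀ x, x = 0 ∨ x = 1 ∨ x = 2 ∨ x = 3 ∨ x = 4 ∨ x = 5 ∨ x = 11 → s'.reg x = s.reg x)
    (ha : ∀ a i, a ≠ 4 → a ≠ 7 → s'.arr a i = s.arr a i)
    (ha7 : ∀ i, s'.arr 7 i = if i = u then offset nb u + q u + 1 else s.arr 7 i)
    (ha4 : ∀ i, s'.arr 4 i =
      if i = u ∧ σ.depth (nb u)[q u] < σ.depth u ∧ σ.parent u ≠ some (nb u)[q u] then 1
      else s.arr 4 i) :
    DFSRep G k nb s' σ (Function.update q u (q u + 1)) pos := by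
  have hI := DFSInv.of_reachable h.reach
  have hmono : ∀ i, s.arr 4 i = 1 → s'.arr 4 i = 1 := fun i hi => by
    rw [ha4]
    split_ifs
    · rfl
    · exact hi
  refine ⟨h.reach, (hr 0 (by simp)).trans h.reg0, (hr 1 (by simp)).trans h.reg1,
    (hr 5 (by simp)).trans h.reg5, (hr 11 (by simp)).trans h.reg11,
    fun i => (ha 0 i (by simp) (by simp)).trans (h.arr0 i),
    fun v j hj => (ha 1 _ (by simp) (by simp)).trans (h.arr1 v j hj),
    fun i => (ha 5 i (by simp) (by simp)).trans (h.arr5 i),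
    fun i => (ha 9 i (by simp) (by simp)).trans (h.arr9 i),
    (hr 2 (by simp)).trans h.cur, fun v => (ha 2 _ (by simp) (by simp)).trans (h.parent v),
    fun v => (ha 3 _ (by simp) (by simp)).trans (h.depth v),
    fun v hv => (ha 6 _ (by simp) (by simp)).trans (h.visited v hv),
    fun v hv => (ha 6 _ (by simp) (by simp)).trans (h.unvisited v hv),
    (hr 3 (by simp)).trans_le h.idx_le, fun v hv => h.idx v (by rwa [hr 3 (by simp)] at hv),
    fun h' => h.idx_stack (by rwa [hr 3 (by simp)] at h'), ?_, ?_, ?_, ?_, ?_, ?_,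
    fun v hv => (h.pos_lt v hv).trans_eq (hr 4 (by simp)).symm,
    fun v hv => (ha 8 _ (by simp) (by simp)).trans (h.order v hv),
    fun j hj => h.pos_surj j (by rwa [hr 4 (by simp)] at hj), h.pos_parent, h.depth_le⟩
  · intro v hv
    rw [ha7]
    by_cases hvu : v = u
    · subst hvu
      simp [add_assoc]
    · rw [if_neg (fun h' => hvu (Fin.ext h')), Function.update_of_ne hvu, h.ptr v hv]
  · intro v hv
    by_cases hvu : v = u
    · subst hvu
      simpa using hq
    · rw [Function.update_of_ne hvu]
      exact h.q_le v hv
  · intro v hv hvs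
    have hvu : v ≠ u := fun h' => hvs (h' ▸ hu)
    rw [Function.update_of_ne hvu]
    exact h.q_finished v hv hvs
  · intro v hv j hj hjq
    by_cases hvu : v = u
    · subst hvu
      rw [Function.update_self, Nat.lt_succ_iff_lt_or_eq] at hjq
      rcases hjq with hjq | rfl
      · obtain ⟨h1, h2⟩ := h.scanned v hv j hj hjq
        exact ⟨h1, fun h3 h4 => hmono _ (h2 h3 h4)⟩
      · exact ⟨hw, fun h1 h2 => by rw [ha4, if_pos ⟨rfl, h1, h2⟩]⟩
    · rw [Function.update_of_ne hvu] at hjq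
      obtain ⟨h1, h2⟩ := h.scanned v hv j hj hjq
      exact ⟨h1, fun h3 h4 => hmono _ (h2 h3 h4)⟩
  · intro v
    rw [ha4]
    split_ifs
    · exact .inr rfl
    · exact h.mark_cases v
  · intro v hv
    rw [ha4] at hv
    split_ifs at hv with h'
    · obtain ⟨h1, h2, h3⟩ := h'
      obtain rfl := Fin.ext h1
      exact ⟨hI.stack_visited _ hu, _, hw, ((hadj v).2 _).1 (List.getElem_mem _), h2, h3⟩
    · exact h.mark v hv

/-- An exhausted pointer means that every neighbour has been scanned and hence discovered, which is
what `backtrack` requires. The entry below `u` on the stack is its parent. -/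
theorem DFSRep.pop (h : DFSRep G k nb s σ q pos) (hadj : IsAdjList G nb) {u : Fin n}
    {rest : List (Fin n)} (hst : σ.stack = u :: rest) (hq : q u = (nb u).length)
    (hidx : s.reg 3 < n)
    (hr : ∀ x, x = 0 ∨ x = 1 ∨ x = 3 ∨ x = 4 ∨ x = 5 ∨ x = 11 → s'.reg x = s.reg x)
    (hr2 : s'.reg 2 = code (σ.parent u)) (ha : s'.arr = s.arr) :
    DFSRep G k nb s' { σ with stack := rest } q pos := by
  have hI := DFSInv.of_reachable h.reach
  have hu : u ∈ σ.visited := hI.stack_visited u (by simp [hst])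
  have hstep : DFSStep G σ { σ with stack := rest } := by
    refine .backtrack σ u rest hst fun w hw => ?_
    obtain ⟨j, hj, rfl⟩ := List.getElem_of_mem (((hadj u).2 w).2 hw)
    exact (h.scanned u hu j hj (hq ▸ hj)).1
  have hch := hI.chain
  rw [hst] at hch
  refine ⟨h.reach.tail hstep, (hr 0 (by simp)).trans h.reg0, (hr 1 (by simp)).trans h.reg1,
    (hr 5 (by simp)).trans h.reg5, (hr 11 (by simp)).trans h.reg11, ha ▸ h.arr0, ha ▸ h.arr1,
    ha ▸ h.arr5, ha ▸ h.arr9, ?_, ha ▸ h.parent, ha ▸ h.depth, ha ▸ h.visited, ha ▸ h.unvisited,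
    (hr 3 (by simp)).trans_le h.idx_le, fun v hv => h.idx v (by rwa [hr 3 (by simp)] at hv),
    fun h' => ?_, ha ▸ h.ptr, h.q_le, ?_, ha ▸ h.scanned, ha ▸ h.mark_cases, ha ▸ h.mark,
    fun v hv => (h.pos_lt v hv).trans_eq (hr 4 (by simp)).symm,
    ha ▸ h.order,
    fun j hj => h.pos_surj j (by rwa [hr 4 (by simp)] at hj), h.pos_parent, h.depth_le⟩
  · rw [hr2, hch.1]
  · rw [hr 3 (by simp)] at h'
    omega
  · intro v hv hvs
    by_cases hvu : v = u
    · rw [hvu, hq]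
    · exact h.q_finished v hv (by simp [hst, hvu]; exact hvs)

theorem DFSRep.next (h : DFSRep G k nb s σ q pos) (hst : σ.stack = []) (hidx : s.reg 3 < n)
    (hvis : ⟨s.reg 3, hidx⟩ ∈ σ.visited)
    (hr : ∀ x, x = 0 ∨ x = 1 ∨ x = 2 ∨ x = 4 ∨ x = 5 ∨ x = 11 → s'.reg x = s.reg x)
    (hr3 : s'.reg 3 = s.reg 3 + 1) (ha : s'.arr = s.arr) : DFSRep G k nb s' σ q pos := by
  refine ⟨h.reach, (hr 0 (by simp)).trans h.reg0, (hr 1 (by simp)).trans h.reg1,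
    (hr 5 (by simp)).trans h.reg5, (hr 11 (by simp)).trans h.reg11, ha ▸ h.arr0, ha ▸ h.arr1,
    ha ▸ h.arr5, ha ▸ h.arr9, (hr 2 (by simp)).trans h.cur, ha ▸ h.parent, ha ▸ h.depth,
    ha ▸ h.visited, ha ▸ h.unvisited, hr3.trans_le hidx, fun v hv => ?_, fun _ => hst,
    ha ▸ h.ptr, h.q_le, h.q_finished, ha ▸ h.scanned, ha ▸ h.mark_cases, ha ▸ h.mark,
    fun v hv => (h.pos_lt v hv).trans_eq (hr 4 (by simp)).symm, ha ▸ h.order,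
    fun j hj => h.pos_surj j (by rwa [hr 4 (by simp)] at hj), h.pos_parent, h.depth_le⟩
  rw [hr3, Nat.lt_succ_iff_lt_or_eq] at hv
  rcases hv with hv | hv
  · exact h.idx v hv
  · rwa [← show v = ⟨s.reg 3, hidx⟩ from Fin.ext hv] at hvis

open Classical in
/-- The number of loop iterations that are still to come, for a vertex `v`. -/
noncomputable def remaining (nb : Fin n → List (Fin n)) (σ : DFSState (Fin n)) (q : Fin n → ℕ)
    (v : Fin n) : ℕ :=
  -- A vertex on the stack still has to scan the rest of its list and be popped once; an
  -- undiscovered one has its discovery to pay for as well.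
  if v ∈ σ.visited then (nb v).length - q v + (if v ∈ σ.stack then 1 else 0)
  else (nb v).length + 2

/-- The number of loop iterations that are still to come. -/
noncomputable def dfsPotential (nb : Fin n → List (Fin n)) (σ : DFSState (Fin n))
    (q : Fin n → ℕ) (i : ℕ) : ℕ := (n - i) + ∑ v, remaining nb σ q v

theorem dfsPotential_lt {q' : Fin n → ℕ} {i : ℕ} (u : Fin n)
    (hu : remaining nb σ' q' u < remaining nb σ q u)
    (hv : ∀ v, v ≠ u → remaining nb σ' q' v = remaining nb σ q v) :
    dfsPotential nb σ' q' i < dfsPotential nb σ q i := by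
  refine Nat.add_lt_add_left (Finset.sum_lt_sum (fun v _ => ?_) ⟨u, Finset.mem_univ u, hu⟩) _
  by_cases h : v = u
  · exact h ▸ hu.le
  · exact (hv v h).le

theorem remaining_visit {w : Fin n} (hw : w ∉ σ.visited)
    (hvis : ∀ v, v ∈ σ'.visited ↔ v = w ∨ v ∈ σ.visited) (hst : σ'.stack = w :: σ.stack) (i : ℕ) :
    dfsPotential nb σ' (Function.update q w 0) i < dfsPotential nb σ q i := by
  refine dfsPotential_lt w ?_ fun v hv => ?_
  · simp [remaining, hvis, hw, hst]
  · have hiff : v ∈ σ'.visited ↔ v ∈ σ.visited := by simp [hvis, hv]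
    by_cases h : v ∈ σ.visited
    · simp [remaining, hst, hv, hiff.2 h, h]
    · simp [remaining, mt hiff.1 h, h]

theorem remaining_scan {u : Fin n} (hu : u ∈ σ.visited) (hq : q u < (nb u).length) (i : ℕ) :
    dfsPotential nb σ (Function.update q u (q u + 1)) i < dfsPotential nb σ q i := by
  refine dfsPotential_lt u ?_ fun v hv => ?_
  · simp only [remaining, hu, if_true, Function.update_self]
    omega
  · simp [remaining, hv]

/-- Depth falls strictly down the stack. Without this, popping `u` need not lower its share of the
potential. -/
theorem DFSInv.notMem_rest {V : Type*} {G : SimpleGraph V} {σ : DFSState V} (h : DFSInv G σ)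
    {u : V} {rest : List V} (hst : σ.stack = u :: rest) : u ∉ rest := by
  have hch := h.chain
  rw [hst] at hch
  intro hu
  cases rest with
  | nil => simp at hu
  | cons b rest =>
    have h1 := (hch.2.anc u hu).depth_le h.depth_lt
    have h2 := h.depth_lt b u hch.1
    omega

theorem remaining_pop (hI : DFSInv G σ) {u : Fin n} {rest : List (Fin n)}
    (hst : σ.stack = u :: rest) (i : ℕ) :
    dfsPotential nb { σ with stack := rest } q i < dfsPotential nb σ q i := by
  refine dfsPotential_lt u ?_ fun v hv => ?_
  · simp [remaining, hI.stack_visited u (by simp [hst]), hst, hI.notMem_rest hst]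
  · simp [remaining, hst, hv]

end Simulation
end KIndep
namespace KIndep
-- Verification of both machine programs.
section
variable {n : ℕ} {G : SimpleGraph (Fin n)} {k : ℕ} {nb : Fin n → List (Fin n)} {s s' : Mem}
  {σ σ' : DFSState (Fin n)} {q pos : Fin n → ℕ}

/-- The loop invariant of `dfsCmd`. -/
def DFSLoopInv (G : SimpleGraph (Fin n)) (k : ℕ) (nb : Fin n → List (Fin n)) (N : ℕ) (s : Mem) :
    Prop :=
  ∃ σ q pos, DFSRep G k nb s σ q pos ∧ dfsPotential nb σ q (s.reg 3) = N

/-- Describes the final memory only by the facts that `DFSRep.visit` consumes, so that the block is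
executed symbolically once for both of its uses. -/
theorem wp_visitCmd {W : ℕ} {Q : Mem → Prop} {w : ℕ} (hw : s.reg 9 = w) (h5 : s.reg 5 = 1)
    (hW4 : s.reg 4 + 1 ≤ W) (hW9 : w + 1 ≤ W)
    (hQ : ∀ s' : Mem, (∀ x, x ≠ 16 → x ≠ 4 → x ≠ 2 → s'.reg x = s.reg x) → s'.reg 2 = w + 1 →
      s'.reg 4 = s.reg 4 + 1 →
      (∀ a i, a = 0 ∨ a = 1 ∨ a = 4 ∨ a = 5 ∨ a = 9 → s'.arr a i = s.arr a i) →
      (∀ i, s'.arr 2 i = if i = w then s.reg 15 else s.arr 2 i) →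
      (∀ i, s'.arr 3 i = if i = w then s.reg 12 else s.arr 3 i) →
      (∀ i, s'.arr 6 i = if i = w then 1 else s.arr 6 i) →
      (∀ i, s'.arr 7 i = if i = w then s.arr 0 w else s.arr 7 i) →
      (∀ i, s'.arr 8 i = if i = s.reg 4 then w else s.arr 8 i) → Q s') :
    visitCmd.wp W Q s := by
  subst hw
  simp only [visitCmd, Cmd.block, Cmd.wp, Mem.reg_setReg, Mem.reg_setArr, h5]
  refine ⟨by simpa using hW4, by simpa using hW9, hQ _ ?_ ?_ ?_ ?_ ?_ ?_ ?_ ?_ ?_⟩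
  · intro x h1 h2 h3
    simp [Mem.reg_setReg, Mem.reg_setArr, h1, h2, h3]
  · simp [Mem.reg_setReg]
  · simp [Mem.reg_setReg]
  · rintro a i (rfl | rfl | rfl | rfl | rfl) <;> simp [Mem.arr_setArr, Mem.arr_setReg]
  all_goals
    intro i
    simp [Mem.arr_setArr, Mem.arr_setReg]

theorem wp_scanCmd {W : ℕ} {Q : Mem → Prop} {u w : ℕ} (hu : s.reg 6 = u) (hw : s.reg 9 = w)
    (h5 : s.reg 5 = 1) (hW7 : s.reg 7 + 1 ≤ W) (hW9 : w + 1 ≤ W)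
    (hQ : ∀ s' : Mem, (∀ x, x ≠ 7 → x ≠ 9 → x ≠ 12 → x ≠ 13 → x ≠ 14 → s'.reg x = s.reg x) →
      (∀ a i, a ≠ 4 → a ≠ 7 → s'.arr a i = s.arr a i) →
      (∀ i, s'.arr 7 i = if i = u then s.reg 7 + 1 else s.arr 7 i) →
      (∀ i, s'.arr 4 i = if i = u ∧ s.arr 3 w < s.arr 3 u ∧ s.arr 2 u ≠ w + 1 then 1
        else s.arr 4 i) → Q s') :
    scanCmd.wp W Q s := by
  subst hu hw
  simp [scanCmd, Cmd.block, Cmd.wp, Mem.reg_setReg, Mem.reg_setArr, Mem.arr_setReg,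
    Mem.arr_setArr, h5]
  -- Four branches: a shallower neighbour whose code is larger than, smaller than or equal to that
  -- of the parent, and a neighbour that is not shallower.
  refine ⟨hW7, fun h1 => ⟨hW9, fun h2 => ?_, fun h2 => ⟨fun h3 => ?_, fun h3 => ?_⟩⟩, fun h1 => ?_⟩
  all_goals
    refine hQ _ (fun x h7 h9 h12 h13 h14 => ?_) (fun a i h4 h7 => ?_) (fun i => ?_) (fun i => ?_)
  · simp [Mem.reg_setReg, Mem.reg_setArr, h7, h9, h12, h13, h14]
  · simp [Mem.arr_setReg, Mem.arr_setArr, h4, h7]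
  · simp [Mem.arr_setReg, Mem.arr_setArr]
  · simp [Mem.arr_setReg, Mem.arr_setArr, h1, (Nat.lt_succ_of_le h2).ne]
  · simp [Mem.reg_setReg, Mem.reg_setArr, h7, h9, h12, h13, h14]
  · simp [Mem.arr_setReg, Mem.arr_setArr, h4, h7]
  · simp [Mem.arr_setReg, Mem.arr_setArr]
  · simp [Mem.arr_setReg, Mem.arr_setArr, h1, h3.ne']
  · simp [Mem.reg_setReg, Mem.reg_setArr, h7, h9, h12, h13, h14]
  · simp [Mem.arr_setReg, Mem.arr_setArr, h7]
  · simp [Mem.arr_setReg, Mem.arr_setArr]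
  · have h4 : s.arr 2 (s.reg 6) = s.reg 9 + 1 := le_antisymm h3 h2
    simp [Mem.arr_setReg, Mem.arr_setArr, h4]
  · simp [Mem.reg_setReg, Mem.reg_setArr, h7, h12, h13]
  · simp [Mem.arr_setReg, Mem.arr_setArr, h7]
  · simp [Mem.arr_setReg, Mem.arr_setArr]
  · simp [Mem.arr_setReg, Mem.arr_setArr, h1.not_gt]

theorem wp_dfsBody {W : ℕ} (hadj : IsAdjList G nb) (hW : n + 2 * G.edgeSet.ncard + 1 ≤ W)
    (N : ℕ) (s : Mem) (hs : DFSLoopInv G k nb N s) (hlt : s.reg 3 < s.reg 0) :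
    dfsBody.wp W (fun s' => ∃ N' < N, DFSLoopInv G k nb N' s') s := by
  obtain ⟨σ, q, pos, h, rfl⟩ := hs
  have hI := DFSInv.of_reachable h.reach
  rw [h.reg0] at hlt
  have hcount := h.count_le
  simp only [dfsBody, Cmd.block, Cmd.wp, h.reg11]
  refine ⟨fun hcur => ?_, fun hcur => ?_⟩
  · rcases hst : σ.stack with _ | ⟨u, rest⟩
    · simp [h.cur, hst, code_none] at hcur
    have hu : u ∈ σ.visited := hI.stack_visited u (by simp [hst])
    have hW7 : offset nb u + (nb u).length ≤ 2 * G.edgeSet.ncard := by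
      rw [← sum_length_eq nb hadj, ← offset_succ]
      exact offset_le nb _
    have hq := h.q_le u hu
    have hlen : s.arr 0 (u + 1) = offset nb u + (nb u).length := by
      rw [h.arr0, offset_succ]
    have hcu : s.reg 2 = u + 1 := by rw [h.cur, hst]; rfl
    simp only [Mem.reg_setReg, Mem.arr_setReg, h.reg5, hcu, Nat.reduceEqDiff, if_true, if_false,
      Nat.add_sub_cancel, h.ptr u hu, hlen]
    refine ⟨fun hpos => ?_, fun hpos => ?_⟩
    · have hqlt : q u < (nb u).length := by omega
      obtain ⟨w, hwdef⟩ : ∃ w, w = (nb u)[q u] := ⟨_, rfl⟩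
      have huw : G.Adj u w := ((hadj u).2 _).1 (hwdef ▸ List.getElem_mem _)
      rw [h.arr1 u (q u) hqlt, ← hwdef]
      refine ⟨fun hvis => ?_, fun hvis => ?_⟩
      · have hw : w ∉ σ.visited := fun hw => by
          rw [h.visited _ hw] at hvis
          exact lt_irrefl _ hvis
        have h4 := hcount.2 w hw
        -- The new depth fits into a word: the depth of `u` is at most its discovery number, which
        -- is below the counter and so below `n`.
        have hdle := h.depth_le u hu
        have hplt := h.pos_lt u hu
        rw [h.depth u]
        refine ⟨by omega, ?_⟩
        refine wp_visitCmd (w := w) (by simp [Mem.reg_setReg]) (by simp [Mem.reg_setReg, h.reg5])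
          (by simp [Mem.reg_setReg]; omega) (by have := w.2; omega) ?_
        intro s' hr hr2 hr4 ha ha2 ha3 ha6 ha7 ha8
        simp [Mem.reg_setReg, Mem.arr_setReg] at hr4 ha ha2 ha3 ha6 ha7 ha8
        have hrep := h.visit (s' := s') (w := w) (o := some u) (d := σ.depth u + 1) hw hlt
          (.descend σ u w rest hst huw hw) (by simp [Function.update_apply])
          (by simp [Function.update_apply]) (by simp) (by simp [hst])
          (by rintro _ ⟨⟩; exact hu) (by omega) ?_ hr2 hr4 ?_ ?_ ha3 ha6 ?_ ha8
        · refine ⟨_, ?_, _, _, _, hrep, rfl⟩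
          rw [show s'.reg 3 = s.reg 3 by rw [hr 3] <;> simp [Mem.reg_setReg]]
          exact remaining_visit hw (by simp) (by simp [hst]) _
        · rintro x (rfl | rfl | rfl | rfl | rfl) <;> rw [hr] <;> simp [Mem.reg_setReg]
        · exact ha
        · exact ha2
        · simpa [h.arr0] using ha7
      · have hw : w ∈ σ.visited := by
          by_contra hw
          rw [h.unvisited _ hw] at hvis
          exact hvis one_pos
        refine wp_scanCmd (u := u) (w := w) (by simp [Mem.reg_setReg]) (by simp [Mem.reg_setReg])
          (by simp [Mem.reg_setReg, h.reg5]) (by simp [Mem.reg_setReg]; omega)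
          (by have := w.2; omega) ?_
        intro s' hr ha ha7 ha4
        simp [Mem.reg_setReg, Mem.arr_setReg] at ha ha7 ha4
        have hrep := h.scan (s' := s') (u := u) hadj (by simp [hst]) hqlt (hwdef ▸ hw) ?_ ha ha7 ?_
        · refine ⟨_, ?_, _, _, _, hrep, rfl⟩
          rw [show s'.reg 3 = s.reg 3 by rw [hr 3] <;> simp [Mem.reg_setReg]]
          exact remaining_scan hu hqlt _
        · rintro x (rfl | rfl | rfl | rfl | rfl | rfl | rfl) <;> rw [hr] <;> simp [Mem.reg_setReg]
        · intro i
          have : code (σ.parent u) = w + 1 ↔ σ.parent u = some w := by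
            rcases σ.parent u with _ | x
            · simp [code_none]
            · simp [code_some, Fin.val_inj]
          rw [ha4]
          exact if_congr (by rw [← hwdef, h.depth, h.depth, h.parent, this]) rfl rfl
    · have hqeq : q u = (nb u).length := by omega
      have hrep := h.pop (s' := ((((s.setReg 6 u).setReg 7 (offset nb u + q u)).setReg 8
        (offset nb u + (nb u).length)).setReg 2 (s.arr 2 u))) hadj hst hqeq hlt ?_ ?_ rfl
      · refine ⟨_, ?_, _, _, _, hrep, rfl⟩
        simpa [Mem.reg_setReg] using remaining_pop hI hst (s.reg 3)
      · rintro x (rfl | rfl | rfl | rfl | rfl | rfl) <;> simp [Mem.reg_setReg]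
      · simp [Mem.reg_setReg, h.parent]
  · rcases hst : σ.stack with _ | ⟨u, rest⟩
    · simp only [Mem.reg_setReg, h.reg5, Nat.reduceEqDiff, if_true, if_false]
      refine ⟨fun hvis => ?_, fun hvis => ?_⟩
      · have hw : (⟨s.reg 3, hlt⟩ : Fin n) ∉ σ.visited := fun hw => by
          have := h.visited _ hw
          simp only at this
          omega
        have h4 := hcount.2 _ hw
        refine ⟨Nat.zero_le _, Nat.zero_le _, ?_⟩
        refine wp_visitCmd (w := s.reg 3) (by simp [Mem.reg_setReg])
          (by simp [Mem.reg_setReg, h.reg5]) (by simp [Mem.reg_setReg]; omega) (by omega) ?_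
        intro s' hr hr2 hr4 ha ha2 ha3 ha6 ha7 ha8
        simp [Mem.reg_setReg, Mem.arr_setReg] at hr4 ha ha2 ha3 ha6 ha7 ha8
        have hrep := h.visit (s' := s') (w := ⟨s.reg 3, hlt⟩) (o := none) (d := 0) hw hlt
          (.root σ ⟨s.reg 3, hlt⟩ hst hw) (by simp [Function.update_apply])
          (by simp [Function.update_apply]) (by simp) (by simp [hst])
          (by simp) (Nat.zero_le _) ?_ hr2 hr4 ?_ ?_ ha3 ha6 ?_ ha8
        · refine ⟨_, ?_, _, _, _, hrep, rfl⟩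
          rw [show s'.reg 3 = s.reg 3 by rw [hr 3] <;> simp [Mem.reg_setReg]]
          exact remaining_visit hw (by simp) (by simp [hst]) _
        · rintro x (rfl | rfl | rfl | rfl | rfl) <;> rw [hr] <;> simp [Mem.reg_setReg]
        · exact ha
        · exact ha2
        · simpa [h.arr0] using ha7
      · have hw : (⟨s.reg 3, hlt⟩ : Fin n) ∈ σ.visited := by
          by_contra hw
          have := h.unvisited _ hw
          simp only at this
          omega
        refine ⟨by omega, ?_⟩
        have hrep := h.next (s' := (s.setReg 10 (s.arr 6 (s.reg 3))).setReg 3 (s.reg 3 + 1)) hst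
          hlt hw ?_ ?_ rfl
        · refine ⟨_, ?_, _, _, _, hrep, rfl⟩
          simp only [Mem.reg_setReg, if_true, dfsPotential]
          omega
        · rintro x (rfl | rfl | rfl | rfl | rfl | rfl) <;> simp [Mem.reg_setReg]
        · simp [Mem.reg_setReg]
    · simp [h.cur, hst, code_some] at hcur

theorem DFSRep.init (G : SimpleGraph (Fin n)) (k : ℕ) (nb : Fin n → List (Fin n)) :
    DFSRep G k nb ((inputMem k nb).setReg 5 1) (DFSState.init (Fin n)) (fun _ => 0)
      fun _ => 0 := by
  constructor
  case reach => exact .refl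
  case arr1 => exact fun v j hj => inputMem_arr_one nb k v j hj
  all_goals
    simp [Mem.reg_setReg, Mem.arr_setReg, inputMem, DFSState.init, offset, code]

/-- Phase A on the machine. -/
theorem exec_dfsCmd {W : ℕ} (hadj : IsAdjList G nb) (hW : n + 2 * G.edgeSet.ncard + 1 ≤ W) :
    ∃ t s' D q pos, t ≤ (dfsBody.size + 1) * (3 * n + 2 * G.edgeSet.ncard) + 2 ∧
      Exec W dfsCmd (inputMem k nb) t s' ∧ DFSRep G k nb s' D q pos ∧ IsDFSResult G D := by
  have hpot : dfsPotential nb (DFSState.init (Fin n)) (fun _ => 0)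
      (((inputMem k nb).setReg 5 1).reg 3) = 3 * n + 2 * G.edgeSet.ncard := by
    simp [dfsPotential, remaining, DFSState.init, Mem.reg_setReg, inputMem,
      Finset.sum_add_distrib, sum_length_eq nb hadj]
    ring
  obtain ⟨t, s', ht, he, ⟨_, D, q, pos, h, -⟩, hend⟩ := exec_whileLt (W := W) (x := 3) (y := 0)
    (DFSLoopInv G k nb) (wp_dfsBody hadj hW) ⟨_, _, _, DFSRep.init G k nb, hpot⟩
  rw [h.reg0] at hend
  -- When the candidates for roots are used up, `idx` says that everything is discovered and
  -- `idx_stack` that the stack is empty.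
  have hidx : s'.reg 3 = n := le_antisymm h.idx_le (not_lt.1 hend)
  refine ⟨1 + t, s', D, q, pos, by omega, ?_, h, h.reach, h.idx_stack hidx,
    fun v => h.idx v (hidx ▸ v.2)⟩
  exact .seq _ _ _ _ _ _ _ (.const _ _ _ (by omega)) he

/-- In the end every list has been scanned, so each back edge was seen from its deeper endpoint. The
shallower endpoint cannot have the deeper one as parent, so the program need not test this. -/
theorem DFSRep.mark_iff {D : DFSState (Fin n)} (h : DFSRep G k nb s D q pos)
    (hadj : IsAdjList G nb) (hD : IsDFSResult G D) (v : Fin n) :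
    s.arr 4 v = 1 ↔ v ∈ marked G D := by
  have hI := DFSInv.of_reachable h.reach
  constructor
  · intro hv
    obtain ⟨-, w, -, hvw, hlt, hpar⟩ := h.mark v hv
    exact ⟨w, ⟨hvw, hpar, fun h' => (hI.depth_lt v w h').not_gt hlt⟩, hlt⟩
  · rintro ⟨w, ⟨hvw, hpar, -⟩, hlt⟩
    obtain ⟨j, hj, rfl⟩ := List.getElem_of_mem (((hadj v).2 w).2 hvw)
    have hq := h.q_finished v (hD.2.2 v) (by simp [hD.2.1])
    exact (h.scanned v (hD.2.2 v) j hj (hq ▸ hj)).2 hlt hpar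

/-- One step of the pruning: the next vertex in reverse order of discovery. -/
def pruneBody : Cmd := .block
  [.sub 4 4 5, .load 6 8 4, .load 7 4 6,
    .ifLt 7 5
      (.block [.load 9 9 6, .add 9 9 5,
        .ifLt 9 1
          (.block [.store 5 6 5, .load 10 2 6,
            .ifLt 11 10
              (.block [.sub 10 10 5, .load 13 4 10,
                .ifLt 13 5 (.block [.load 12 9 10, .add 12 12 9, .store 9 10 12]) .skip])
              .skip])
          .skip])
      .skip]

/-- Pruning of the forest on the unmarked vertices. -/
def pruneCmd : Cmd := .whileLt 11 4 pruneBody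

open Classical in
/-- The memory after the pruning of the vertices discovered at or after time `c`. -/
structure PruneRep (k : ℕ) (D : DFSState (Fin n)) (U : Set (Fin n)) (raw pos : Fin n → ℕ)
    (c : ℕ) (s : Mem) : Prop where
  reg1 : s.reg 1 = k
  reg4 : s.reg 4 = c
  reg5 : s.reg 5 = 1
  reg11 : s.reg 11 = 0
  parent : ∀ v : Fin n, s.arr 2 v = code (D.parent v)
  mark : ∀ v : Fin n, s.arr 4 v < 1 ↔ v ∈ U
  order : ∀ v, s.arr 8 (pos v) = v
  surj : ∀ j < c, ∃ v, pos v = j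
  out : ∀ v : Fin n, s.arr 5 v = 1 ↔ c ≤ pos v ∧ v ∈ U ∧ raw v < k
  acc : ∀ v : Fin n, s.arr 9 v =
    ∑ w with restrictParent D U w = some v ∧ c ≤ pos w, pruned k (raw w)

-- Array 8 recovers a vertex from its discovery number, so `v` is the only vertex with number `c`,
-- and each accumulator gains at most the one term of `v`.
open Classical in
theorem PruneRep.step {D : DFSState (Fin n)} {U : Set (Fin n)} {raw : Fin n → ℕ} {c : ℕ}
    (h : PruneRep k D U raw pos (c + 1) s) {v : Fin n} (hv : pos v = c)
    (hr : ∀ x, x = 1 ∨ x = 5 ∨ x = 11 → s'.reg x = s.reg x) (hr4 : s'.reg 4 = c)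
    (ha : ∀ a i, a = 2 ∨ a = 4 ∨ a = 8 → s'.arr a i = s.arr a i)
    (ha5 : ∀ i, s'.arr 5 i = if i = v ∧ v ∈ U ∧ raw v < k then 1 else s.arr 5 i)
    (ha9 : ∀ i : Fin n, s'.arr 9 i =
      s.arr 9 i + if restrictParent D U v = some i then pruned k (raw v) else 0) :
    PruneRep k D U raw pos c s' := by
  have hinj : ∀ w, pos w = c → w = v := fun w hw => by
    have h1 := h.order w
    rw [hw, ← hv, h.order v] at h1
    exact Fin.ext h1.symm
  have hle : ∀ w, c ≤ pos w ↔ w = v ∨ c + 1 ≤ pos w := fun w => by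
    constructor
    · intro hw
      rcases hw.eq_or_lt with hw | hw
      · exact .inl (hinj w hw.symm)
      · exact .inr hw
    · rintro (rfl | hw)
      · exact hv.ge
      · omega
  refine ⟨(hr 1 (by simp)).trans h.reg1, hr4, (hr 5 (by simp)).trans h.reg5,
    (hr 11 (by simp)).trans h.reg11, fun w => (ha 2 _ (by simp)).trans (h.parent w),
    fun w => by rw [ha 4 _ (by simp)]; exact h.mark w,
    fun w => (ha 8 _ (by simp)).trans (h.order w), fun j hj => h.surj j (by omega), ?_, ?_⟩
  · intro w
    rw [ha5, hle]
    by_cases hwv : w = v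
    · subst hwv
      by_cases hw : w ∈ U ∧ raw w < k
      · simp [hw]
      · simp only [true_and, hw, if_false, h.out w, true_or, iff_false]
        tauto
    · simp [Fin.val_inj, hwv, h.out w]
  · intro u
    rw [ha9, h.acc u]
    by_cases hpu : restrictParent D U v = some u
    · have : (Finset.univ.filter fun w => restrictParent D U w = some u ∧ c ≤ pos w) =
          insert v (Finset.univ.filter fun w => restrictParent D U w = some u ∧ c + 1 ≤ pos w) := by
        ext w
        simp only [Finset.mem_filter, Finset.mem_univ, true_and, Finset.mem_insert, hle]
        constructor
        · tauto
        · rintro (rfl | hw)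
          · exact ⟨hpu, .inl rfl⟩
          · exact ⟨hw.1, .inr hw.2⟩
      rw [if_pos hpu, this, Finset.sum_insert (by simp [hv]), add_comm]
    · rw [if_neg hpu, add_zero]
      refine Finset.sum_congr ?_ fun _ _ => rfl
      ext w
      simp only [Finset.mem_filter, Finset.mem_univ, true_and, hle]
      constructor
      · exact fun hw => ⟨hw.1, .inr hw.2⟩
      · rintro ⟨hw, rfl | hw'⟩
        · exact absurd hw hpu
        · exact ⟨hw, hw'⟩

/-- Children have larger discovery numbers than their parent, so all of them have been processed
when `v` is reached and its accumulator is complete (`hacc`). -/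
theorem wp_pruneBody {W : ℕ} {D : DFSState (Fin n)} {U : Set (Fin n)} {raw : Fin n → ℕ}
    (hraw : IsSubtotal (restrictParent D U) k raw)
    (hdep : ∀ u v, D.parent v = some u → D.depth u < D.depth v)
    (hpos : ∀ u v, D.parent v = some u → pos u < pos v) (hW : n + 1 ≤ W) (N : ℕ) (s : Mem)
    (h : PruneRep k D U raw pos N s) (hlt : s.reg 11 < s.reg 4) :
    pruneBody.wp W (fun s' => ∃ N' < N, PruneRep k D U raw pos N' s') s := by
  classical
  rw [h.reg11, h.reg4] at hlt
  obtain ⟨c, rfl⟩ : ∃ c, N = c + 1 := ⟨N - 1, by omega⟩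
  obtain ⟨v, hv⟩ := h.surj c (Nat.lt_succ_self c)
  have hord : s.arr 8 c = v := hv ▸ h.order v
  have hdep' : ∀ u v, restrictParent D U v = some u → D.depth u < D.depth v := fun u v huv =>
    hdep u v (restrictParent_eq_some.1 huv).1
  have hacc : s.arr 9 v + 1 = raw v := by
    rw [h.acc v, hraw v, add_comm]
    congr 1
    refine Finset.sum_congr ?_ fun _ _ => rfl
    ext w
    simp only [Finset.mem_filter, Finset.mem_univ, true_and, and_iff_left_iff_imp]
    intro hw
    have := hpos v w (restrictParent_eq_some.1 hw).1
    omega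
  have hrawle : ∀ w, raw w ≤ n := fun w => by simpa using hraw.le_card hdep' w
  have hfin : ∀ s', (∀ x, x = 1 ∨ x = 5 ∨ x = 11 → s'.reg x = s.reg x) → s'.reg 4 = c →
      (∀ a i, a = 2 ∨ a = 4 ∨ a = 8 → s'.arr a i = s.arr a i) →
      (∀ i : ℕ, s'.arr 5 i = if i = v ∧ v ∈ U ∧ raw v < k then 1 else s.arr 5 i) →
      (∀ i : Fin n, s'.arr 9 i =
        s.arr 9 i + if restrictParent D U v = some i then pruned k (raw v) else 0) →
      ∃ N' < c + 1, PruneRep k D U raw pos N' s' := fun s' h1 h2 h3 h4 h5 =>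
    ⟨c, Nat.lt_succ_self c, h.step hv h1 h2 h3 h4 h5⟩
  simp only [pruneBody, Cmd.block, Cmd.wp, Mem.reg_setReg, Mem.reg_setArr, Mem.arr_setReg,
    Mem.arr_setArr, h.reg1, h.reg4, h.reg5, h.reg11, Nat.reduceEqDiff, if_true, if_false, hord,
    Nat.add_sub_cancel, hacc, h.mark v, h.parent v]
  have hnone : v ∉ U ∨ k ≤ raw v → ∀ i, (if restrictParent D U v = some i then
      pruned k (raw v) else 0) = 0 := by
    rintro (h' | h') i
    · rw [if_neg fun h'' => h' (restrictParent_eq_some.1 h'').2.2]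
    · simp [pruned, h']
  refine ⟨fun hU => ⟨(hrawle v).trans (by omega), fun hk => ⟨fun hp => ?_, fun hp => ?_⟩,
    fun hk => ?_⟩, fun hU => ?_⟩
  · obtain ⟨p, hp⟩ : ∃ p, D.parent v = some p := by
      rcases hp' : D.parent v with _ | p
      · simp [hp', code_none] at hp
      · exact ⟨p, rfl⟩
    simp only [hp, code_some, Nat.add_sub_cancel, h.mark p]
    refine ⟨fun hpU => ⟨?_, hfin _ ?_ ?_ ?_ ?_ ?_⟩, fun hpU => hfin _ ?_ ?_ ?_ ?_ ?_⟩
    · have hvp : restrictParent D U v = some p := restrictParent_eq_some.2 ⟨hp, hpU, hU⟩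
      -- The updated accumulator of `p` is a partial sum of the values returned by the children of
      -- `p`, hence below `raw p ≤ n`: the addition does not overflow.
      have hsub : insert v (Finset.univ.filter fun w =>
          restrictParent D U w = some p ∧ c + 1 ≤ pos w) ⊆
          Finset.univ.filter fun w => restrictParent D U w = some p := by
        intro w
        simp only [Finset.mem_filter, Finset.mem_univ, true_and, Finset.mem_insert]
        rintro (rfl | hw)
        · exact hvp
        · exact hw.1
      have h1 := Finset.sum_le_sum_of_subset (f := fun w => pruned k (raw w)) hsub
      rw [Finset.sum_insert (by simp [hv]), ← h.acc p, pruned, if_neg hk.not_ge] at h1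
      have h2 : s.arr 9 p + raw v + 1 ≤ raw p := by
        rw [hraw p, add_comm 1, add_comm (s.arr 9 p)]
        exact Nat.succ_le_succ (h1.trans_eq (Finset.sum_congr (by ext; simp) fun _ _ => rfl))
      have h3 := hrawle p
      omega
    · rintro x (rfl | rfl | rfl) <;> simp [Mem.reg_setReg, Mem.reg_setArr]
    · simp [Mem.reg_setReg, Mem.reg_setArr]
    · rintro a i (rfl | rfl | rfl) <;> simp [Mem.arr_setArr, Mem.arr_setReg]
    · intro i
      simp [Mem.arr_setArr, Mem.arr_setReg, hU, hk]
    · intro i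
      have hiff : restrictParent D U v = some i ↔ i = p := by
        rw [restrictParent_eq_some, hp]
        aesop
      simp [Mem.arr_setArr, Mem.arr_setReg, hiff, pruned, hk.not_ge, Fin.val_inj]
      by_cases hip : i = p
      · simp [hip]
      · simp [hip]
    · rintro x (rfl | rfl | rfl) <;> simp [Mem.reg_setReg, Mem.reg_setArr]
    · simp [Mem.reg_setReg, Mem.reg_setArr]
    · rintro a i (rfl | rfl | rfl) <;> simp [Mem.arr_setArr, Mem.arr_setReg]
    · intro i
      simp [Mem.arr_setArr, Mem.arr_setReg, hU, hk]
    · intro i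
      rw [if_neg]
      · simp [Mem.arr_setArr, Mem.arr_setReg]
      · rw [restrictParent_eq_some, hp]
        rintro ⟨⟨⟩, h', -⟩
        exact hpU h'
  · have hp : D.parent v = none := by
      rcases hp' : D.parent v with _ | p
      · rfl
      · simp [hp', code_some] at hp
    refine hfin _ ?_ ?_ ?_ ?_ ?_
    · rintro x (rfl | rfl | rfl) <;> simp [Mem.reg_setReg, Mem.reg_setArr]
    · simp [Mem.reg_setReg, Mem.reg_setArr]
    · rintro a i (rfl | rfl | rfl) <;> simp [Mem.arr_setArr, Mem.arr_setReg]
    · intro i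
      simp [Mem.arr_setArr, Mem.arr_setReg, hU, hk]
    · intro i
      rw [if_neg]
      · simp [Mem.arr_setArr, Mem.arr_setReg]
      · simp [restrictParent_eq_some, hp]
  · refine hfin _ ?_ ?_ ?_ ?_ ?_
    · rintro x (rfl | rfl | rfl) <;> simp [Mem.reg_setReg]
    · simp [Mem.reg_setReg]
    · rintro a i (rfl | rfl | rfl) <;> simp [Mem.arr_setReg]
    · intro i
      simp [Mem.arr_setReg, hk]
    · intro i
      rw [hnone (.inr (not_lt.1 hk))]
      rfl
  · refine hfin _ ?_ ?_ ?_ ?_ ?_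
    · rintro x (rfl | rfl | rfl) <;> simp [Mem.reg_setReg]
    · simp [Mem.reg_setReg]
    · rintro a i (rfl | rfl | rfl) <;> simp [Mem.arr_setReg]
    · intro i
      simp [Mem.arr_setReg, hU]
    · intro i
      rw [hnone (.inl hU)]
      rfl

/-- Phase B on the machine. -/
theorem DFSRep.exec_pruneCmd {W : ℕ} {D : DFSState (Fin n)} (h : DFSRep G k nb s D q pos)
    (hadj : IsAdjList G nb) (hD : IsDFSResult G D) (hW : n + 1 ≤ W) :
    ∃ t s' roots S, t ≤ (pruneBody.size + 1) * n + 1 ∧ Exec W pruneCmd s t s' ∧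
      IsRooting G (marked G D)ᶜ roots ∧ PhaseB G k (marked G D)ᶜ roots S ∧ s'.setIn n 5 = S := by
  classical
  have hI := DFSInv.of_reachable h.reach
  have hF := hD.isParentMap
  obtain ⟨raw, hraw⟩ := exists_isSubtotal hF.depth_lt k
  have hcount : s.reg 4 ≤ n := h.count_le.1
  -- At the start the counter exceeds all discovery numbers, and arrays 5 and 9 are still zero after
  -- Phase A.
  have hrep : PruneRep k D (marked G D)ᶜ raw pos (s.reg 4) s := by
    refine ⟨h.reg1, rfl, h.reg5, h.reg11, h.parent, fun v => ?_, fun v => h.order v (hD.2.2 v),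
      fun j hj => (h.pos_surj j hj).imp fun v hv => hv.2, fun v => ?_, fun v => ?_⟩
    · rw [Set.mem_compl_iff, ← h.mark_iff hadj hD]
      have := h.mark_cases v
      omega
    · have := h.pos_lt v (hD.2.2 v)
      simp only [h.arr5, zero_ne_one, false_iff]
      omega
    · rw [h.arr9, Finset.sum_eq_zero]
      intro w hw
      have := h.pos_lt w (hD.2.2 w)
      have := (Finset.mem_filter.1 hw).2.2
      omega
  obtain ⟨t, s', ht, he, ⟨c, hc⟩, hend⟩ := exec_whileLt (W := W) (x := 11) (y := 4)
    (PruneRep k D (marked G D)ᶜ raw pos) (wp_pruneBody hraw hI.depth_lt h.pos_parent hW) hrep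
  obtain rfl : c = 0 := by
    rw [hc.reg11, hc.reg4] at hend
    omega
  set par := restrictParent D (marked G D)ᶜ with hpar
  have hrootU : ∀ r v, Anc par r v → v ∈ (marked G D)ᶜ → r ∈ (marked G D)ᶜ := by
    intro r v hrv hv
    rcases Relation.ReflTransGen.cases_head hrv with rfl | ⟨w, hw, -⟩
    · exact hv
    · exact (restrictParent_eq_some.1 hw).2.1
  -- The roots for the abstract run are the unmarked vertices without an unmarked parent. They occur
  -- only in the proof; the program never lists them.
  have hmem : ∀ r, r ∈ (Finset.univ.filter fun r => r ∈ (marked G D)ᶜ ∧ par r = none).toList ↔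
      r ∈ (marked G D)ᶜ ∧ par r = none := fun r => by simp
  have hcover : ∀ v ∈ (marked G D)ᶜ, ∃ r ∈ (Finset.univ.filter fun r => r ∈ (marked G D)ᶜ ∧
      par r = none).toList, Anc par r v := fun v hv => by
    obtain ⟨r, hr, hrv⟩ := exists_anc_root hF.depth_lt v
    exact ⟨r, (hmem r).2 ⟨hrootU r v hrv hv, hr⟩, hrv⟩
  refine ⟨t, s', _, _, ht.trans (Nat.add_le_add_right (Nat.mul_le_mul_left _ hcount) 1), he,
    ⟨Finset.nodup_toList _, fun r hr => ((hmem r).1 hr).1, fun v hv => ?_⟩,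
    (phaseB_iff hF hraw (fun r hr => ((hmem r).1 hr).2) hcover _).2 rfl, ?_⟩
  · obtain ⟨r, hr, hrv⟩ := hcover v hv
    have htree : ∀ u v, par v = some u → (restrict G (marked G D)ᶜ).Adj u v := fun u v huv =>
      (hF.adj_iff u v).2 (.inl huv)
    refine ⟨r, ⟨hr, hrv.reachable htree⟩, fun r' hr' => ?_⟩
    exact root_eq_of_reachable hF.depth_lt hF.anc_of_adj hr'.2 ((hmem r').1 hr'.1).2
      ((hmem r).1 hr).2 .refl hrv
  · ext v
    exact (hc.out v).trans (by simp)

end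
end KIndep

/-- First part: correctness of every run of the two-phase algorithm, for all choices it leaves
open. Second part: it is implemented by a program of the form `A; B` in linear time. -/
theorem mainTheorem5 :
    (∀ {V : Type*} [Fintype V] (G : SimpleGraph V) (k : ℕ), 2 ≤ k →
      ∀ D : KIndep.DFSState V, KIndep.IsDFSResult G D →
        (∀ u v, KIndep.IsBackEdge G D u v → D.depth u ≠ D.depth v) ∧
        ((KIndep.backEdges G D).ncard : ℤ) = KIndep.cycleDim G ∧
        (G.induce (KIndep.marked G D)ᶜ).IsAcyclic ∧
        (Fintype.card V : ℤ) - KIndep.cycleDim G ≤ ((KIndep.marked G D)ᶜ.ncard : ℤ) ∧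
        ∀ roots : List V, KIndep.IsRooting G (KIndep.marked G D)ᶜ roots →
          (∃ S, KIndep.PhaseB G k (KIndep.marked G D)ᶜ roots S) ∧
          ∀ S, KIndep.PhaseB G k (KIndep.marked G D)ᶜ roots S →
            S ⊆ (KIndep.marked G D)ᶜ ∧
            (∀ c : (G.induce S).ConnectedComponent, c.supp.ncard ≤ k - 1) ∧
            KIndep.IsGenIndep G k S ∧
            ⌈(((k : ℚ) - 1) / k) * ((Fintype.card V : ℚ) - (KIndep.cycleDim G : ℚ))⌉
              ≤ (S.ncard : ℤ)) ∧
    (∃ (A B : KIndep.Cmd) (C : ℕ),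
      ∀ (n : ℕ) (G : SimpleGraph (Fin n)) (k : ℕ), 2 ≤ k →
        ∀ nb : Fin n → List (Fin n), KIndep.IsAdjList G nb →
          ∀ W : ℕ, C * (n + G.edgeSet.ncard + k + 1) ≤ W →
            ∃ (tA tB : ℕ) (s₁ s₂ : KIndep.Mem),
              KIndep.Exec W A (KIndep.inputMem k nb) tA s₁ ∧
              KIndep.Exec W B s₁ tB s₂ ∧
              tA + tB ≤ C * (n + G.edgeSet.ncard + 1) ∧
              ∃ (D : KIndep.DFSState (Fin n)) (roots : List (Fin n)) (S : Set (Fin n)),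
                KIndep.IsDFSResult G D ∧
                s₁.Records D ∧
                s₁.setIn n 4 = KIndep.marked G D ∧
                KIndep.IsRooting G (KIndep.marked G D)ᶜ roots ∧
                KIndep.PhaseB G k (KIndep.marked G D)ᶜ roots S ∧
                s₂.setIn n 5 = S ∧
                KIndep.IsGenIndep G k S ∧
                ⌈(((k : ℚ) - 1) / k) * ((n : ℚ) - (KIndep.cycleDim G : ℚ))⌉
                  ≤ (S.ncard : ℤ)) := by
  refine ⟨fun {V} _ G k hk D hD => ⟨fun u v huv => hD.depth_ne u v huv.1, hD.ncard_backEdges,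
    KIndep.isAcyclic_induce_of_restrict hD.isParentMap.isAcyclic, hD.le_ncard_compl_marked,
    fun roots hr => hD.phaseB_correct hk hr⟩, KIndep.dfsCmd, KIndep.pruneCmd,
    -- Large enough for both loops, at most `3n + 2m` and `n` rounds, and for the word bound `n + 2m
    -- + 1`.
    4 * (KIndep.dfsBody.size + KIndep.pruneBody.size + 4), fun n G k hk nb hadj W hW => ?_⟩
  generalize hm : G.edgeSet.ncard = m at hW ⊢
  have hsum : n + 2 * m + 1 ≤ W := by
    refine le_trans ?_ hW
    nlinarith [Nat.zero_le (KIndep.dfsBody.size + KIndep.pruneBody.size)]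
  obtain ⟨tA, s₁, D, q, pos, htA, hA, hrep, hD⟩ :=
    KIndep.exec_dfsCmd (k := k) (W := W) hadj (by rwa [hm])
  obtain ⟨tB, s₂, roots, S, htB, hB, hroots, hS, hout⟩ :=
    hrep.exec_pruneCmd (W := W) hadj hD (by omega)
  obtain ⟨-, -, hind, hcard⟩ := (hD.phaseB_correct hk hroots).2 S hS
  rw [Fintype.card_fin] at hcard
  refine ⟨tA, tB, s₁, s₂, hA, hB, ?_, D, roots, S, hD, fun v => ⟨hrep.parent v, hrep.depth v⟩,
    ?_, hroots, hS, hout, hind, hcard⟩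
  · rw [hm] at htA
    generalize KIndep.dfsBody.size = a at htA ⊢
    generalize KIndep.pruneBody.size = b at htB ⊢
    nlinarith [Nat.zero_le (a * n), Nat.zero_le (a * m), Nat.zero_le (b * n), Nat.zero_le (b * m)]
  · ext v
    exact hrep.mark_iff hadj hD v
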